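/- **Proposition 4.1.** *Setup.* Let $B$ be a quaternion algebra over $\mathbf{Q}$ that is ramified at the real place, with conjugation $x\mapsto x^*$, $\operatorname{tr}(x)=x+x^*$, $n(x)=xx^*$, and let $B_0\subset B$ be a maximal order. Fix a *good basis* of $B_0$: a $\mathbf{Z}$-basis $1,v_1,v_2,v_3$ of $B_0$ and integers $a,b,c$ such that the Hermitian matrix $$A(T)=\begin{pmatrix} a & v_3 & v_2^*\\ v_3^* & b & v_1\\ v_2 & v_1^* & c\end{pmatrix}\quad\text{is of rank one, i.e. } A(T)\neq 0,\ A(T)^{\#}=0,$$ where, for a Hermitian matrix $h$ with diagonal $c_1,c_2,c_3$ and entries $a_1,a_2,a_3$ in the positions $(2,3),(3,1),(1,2)$, $$h^{\#}=\begin{pmatrix} c_2c_3-n(a_1) & a_2^*a_1^*-c_3a_3 & a_3a_1-c_2a_2^*\\ a_1a_2-c_3a_3^* & c_1c_3-n(a_2) & a_3^*a_2^*-c_1a_1\\ a_1^*a_3^*-c_2a_2 & a_2a_3-c_1a_1^* & c_1c_2-n(a_3)\end{pmatrix}.$$ Let $$T=\begin{pmatrix} a & \tfrac12\operatorname{tr}v_3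 & \tfrac12\operatorname{tr}v_2\\ \tfrac12\operatorname{tr}v_3 & b & \tfrac12\operatorname{tr}v_1\\ \tfrac12\operatorname{tr}v_2 & \tfrac12\operatorname{tr}v_1 & c\end{pmatrix}.$$ Let $\mathbf{A}_f$ be the ring of finite adeles of $\mathbf{Q}$ and $|\cdot|_f$ its idelic absolute value. Write $H_3(B)$ for the Hermitian matrices in $M_3(B)$ and $W=\mathbf{Q}\oplus H_3(B)\oplus H_3(B)\oplus\mathbf{Q}$. Let $\mathrm{GSp}_6$ be the group of $g\in\mathrm{GL}_6$ with $gJ_6\,{}^tg=\nu(g)J_6$, $J_6=\begin{pmatrix}0&1_3\\-1_3&0\end{pmatrix}$. It acts on the right on its space $W_6$ of row vectors, which has the standard basis $e_1,e_2,e_3,f_1,f_2,f_3$. It acts on $W$ through the embedding $$(a,b,c,d)\mapsto a\,e_1\wedge e_2\wedge e_3+\sum_{i,j} b_{ij}\,e_{i+1}\wedge e_{i+2}\wedge f_j+\sum_{i,j} c_{ij}\,f_{i+1}\wedge f_{i+2}\wedge e_j+d\,f_1\wedge f_2\wedge f_3$$ of $W$ into $(\bigwedge^3W_6\otimes\nu^{-1})\otimes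 B$ (indices modulo $3$). Put $f_{\mathcal O}=(0,0,A(T),0)\in W$. Let $\Phi_f$ be the characteristic function on $W(\mathbf{A}_f)$ of the set of $(a,b,c,d)$ such that $a,d\in\widehat{\mathbf{Z}}$ and both $b$ and $c$ have diagonal entries in $\widehat{\mathbf{Z}}$ and off-diagonal entries in $B_0\otimes\widehat{\mathbf{Z}}$. Let $U_P$ be the group of matrices $\begin{pmatrix}1&u\\0&1\end{pmatrix}$ with $u={}^tu$ a $3\times3$ matrix, and $U_0\subset U_P$ its subgroup defined by $\operatorname{tr}(Tu)=0$. Put $\chi\begin{pmatrix}1&u\\0&1\end{pmatrix}=\psi(\operatorname{tr}(Tu))$, where $\psi$ is the finite part of the standard additive character of $\mathbf{Q}\backslash\mathbf{A}$ (trivial on $\widehat{\mathbf{Z}}$, and $\psi(q)=e^{-2\pi i q}$ for $q\in\mathbf{Q}$). Let $du$ be the Haar measure on $U_0(\mathbf{A}_f)\backslash U_P(\mathbf{A}_f)$ for which the set of classes with $\operatorname{tr}(Tu)\in\widehat{\mathbf{Z}}$ has measure $1$. For $\lambda\in\mathrm{GL}_1(\mathbf{A}_f)$ and $m\in\mathrm{GL}_3(\mathbf{A}_f)$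 write $c(m)=\det(m)\,{}^tm^{-1}$, $$(\lambda,m)=\begin{pmatrix}\lambda\det(m)\,{}^tm^{-1}&\\&m\end{pmatrix}\in\mathrm{GSp}_6(\mathbf{A}_f),$$ and let $\Xi(\lambda,m)=1$ if $\lambda\in\widehat{\mathbf{Z}}$, $m\in M_3(\widehat{\mathbf{Z}})$ and $m^{-1}Tc(m)$ is half-integral (symmetric, with diagonal entries in $\widehat{\mathbf{Z}}$ and off-diagonal entries in $\tfrac12\widehat{\mathbf{Z}}$), and $\Xi(\lambda,m)=0$ otherwise. *Claim.* For all $\lambda\in\mathrm{GL}_1(\mathbf{A}_f)$ and $m\in\mathrm{GL}_3(\mathbf{A}_f)$, the function $u\mapsto\chi(u)\,\Phi_f(f_{\mathcal O}\,u\,(\lambda,m))$ on $U_P(\mathbf{A}_f)$ factors through $U_0(\mathbf{A}_f)\backslash U_P(\mathbf{A}_f)$, it is integrable there, and $$\int_{U_0(\mathbf{A}_f)\backslash U_P(\mathbf{A}_f)}\chi(u)\,\Phi_f(f_{\mathcal O}\,u\,(\lambda,m))\,du=|\lambda|_f\,\Xi(\lambda,m).$$ -/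

import Mathlib

open scoped Matrix TensorProduct

noncomputable section

namespace SpinGSp6

/-! ### Finite adeles of `ℚ` -/

/-- The ring `𝔸_f` of finite adeles of `ℚ`. -/
abbrev Af : Type := IsDedekindDomain.FiniteAdeleRing ℤ ℚ

/-- The subring `ℤ̂` of everywhere integral finite adeles. -/
def Zhat : Subring Af where
  carrier := {x | ∀ v : IsDedekindDomain.HeightOneSpectrum ℤ,
    x v ∈ v.adicCompletionIntegers ℚ}
  mul_mem' hx hy := fun v => mul_mem (hx v) (hy v)
  one_mem' := fun _ => one_mem _
  add_mem' hx hy := fun v => add_mem (hx v) (hy v)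
  zero_mem' := fun _ => zero_mem _
  neg_mem' hx := fun v => neg_mem (hx v)

/-- The absolute value on `ℚ_v`, normalized so that a uniformizer at the prime `p` has
absolute value `p⁻¹`. -/
def localAbs (v : IsDedekindDomain.HeightOneSpectrum ℤ) (x : v.adicCompletion ℚ) : ℝ :=
  (WithZeroMulInt.toNNReal (e := (Ideal.absNorm v.asIdeal : NNReal))
    (by simpa [Ideal.absNorm_eq_zero_iff] using v.ne_bot) (Valued.v x) : NNReal)

/-- The finite idelic absolute value `|x|_f = ∏_p |x_p|_p`. -/
def finiteAbs (x : Afˣ) : ℝ :=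
  ∏ᶠ v : IsDedekindDomain.HeightOneSpectrum ℤ, localAbs v ((x : Af) v)

open Classical in
/-- The finite part of the standard additive character of `ℚ \ 𝔸`: it is trivial on `ℤ̂`, and it
is `q ↦ exp (-2πiq)` on the diagonally embedded `ℚ` because the full character is trivial on `ℚ`
and is `x ↦ exp (2πix)` at the real place.  As `𝔸_f = ℚ + ℤ̂` and `ℚ ∩ ℤ̂ = ℤ`, the value does not
depend on the chosen `q`, and the second branch never occurs. -/
def psi (x : Af) : ℂ :=
  if h : ∃ q : ℚ, x - algebraMap ℚ Af q ∈ Zhat then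
    Complex.exp (-(2 * Real.pi * Complex.I * (h.choose : ℂ)))
  else 1

/-! ### Quaternion algebras, orders and Hermitian matrices -/

/-- The `R`-points `B ⊗ R` of the quaternion algebra `B = (α, β)_ℚ`, with basis `1, i, j, ij`,
where `i² = α`, `j² = β`, `ij = -ji`.  Its conjugation is `star`. -/
abbrev Quat (α β : ℚ) (R : Type*) [CommRing R] [Algebra ℚ R] : Type _ :=
  QuaternionAlgebra R (algebraMap ℚ R α) 0 (algebraMap ℚ R β)

/-- The base change map `B → B ⊗ R`. -/
def Quat.base {α β : ℚ} (R : Type*) [CommRing R] [Algebra ℚ R] (x : Quat α β ℚ) : Quat α β R :=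
  ⟨algebraMap ℚ R x.re, algebraMap ℚ R x.imI, algebraMap ℚ R x.imJ, algebraMap ℚ R x.imK⟩

/-- The trace `x + x^*`, as an element of the base ring. -/
def Quat.tr {α β : ℚ} {R : Type*} [CommRing R] [Algebra ℚ R] (x : Quat α β R) : R :=
  (x + star x).re

/-- `B` is ramified at the real place: `B ⊗ ℝ` is not a matrix algebra. -/
def RamifiedAtInfinity (α β : ℚ) : Prop :=
  IsEmpty (Quat α β ℝ ≃ₐ[ℝ] Matrix (Fin 2) (Fin 2) ℝ)

/-- `O` is an order: a subring that is finitely generated over `ℤ` and spans `B` over `ℚ`. -/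
def IsOrder {α β : ℚ} (O : Subring (Quat α β ℚ)) : Prop :=
  (AddSubgroup.toIntSubmodule O.toAddSubgroup).FG ∧
    Submodule.span ℚ (O : Set (Quat α β ℚ)) = ⊤

/-- `O` is a maximal order. -/
def IsMaximalOrder {α β : ℚ} (O : Subring (Quat α β ℚ)) : Prop :=
  IsOrder O ∧ ∀ O' : Subring (Quat α β ℚ), IsOrder O' → O ≤ O' → O' = O

/-- The space `H_3(B ⊗ R)` of three by three Hermitian matrices, `h^* = h`. -/
abbrev H3 (α β : ℚ) (R : Type*) [CommRing R] [Algebra ℚ R] : Type _ :=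
  selfAdjoint (Matrix (Fin 3) (Fin 3) (Quat α β R))

/-- The Hermitian matrix with diagonal `c₁, c₂, c₃` and off-diagonal entries `x₁, x₂, x₃` in the
positions `(2,3)`, `(3,1)`, `(1,2)`. -/
def hermitian {α β : ℚ} {R : Type*} [CommRing R] [Algebra ℚ R]
    (c₁ c₂ c₃ : R) (x₁ x₂ x₃ : Quat α β R) : H3 α β R :=
  ⟨!![algebraMap R _ c₁, x₃, star x₂;
      star x₃, algebraMap R _ c₂, x₁;
      x₂, star x₁, algebraMap R _ c₃], by
    rw [selfAdjoint.mem_iff]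
    ext i j : 1
    rw [Matrix.star_apply]
    fin_cases i <;> fin_cases j <;> simp [QuaternionAlgebra.algebraMap_eq]⟩

/-- The quadratic adjoint `h ↦ h^#`. -/
def sharp {α β : ℚ} {R : Type*} [CommRing R] [Algebra ℚ R]
    (h : Matrix (Fin 3) (Fin 3) (Quat α β R)) : Matrix (Fin 3) (Fin 3) (Quat α β R) :=
  let c₁ := h 0 0
  let c₂ := h 1 1
  let c₃ := h 2 2
  let a₁ := h 1 2
  let a₂ := h 2 0
  let a₃ := h 0 1
  !![c₂ * c₃ - a₁ * star a₁, star a₂ * star a₁ - c₃ * a₃, a₃ * a₁ - c₂ * star a₂;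
     a₁ * a₂ - c₃ * star a₃, c₁ * c₃ - a₂ * star a₂, star a₃ * star a₂ - c₁ * a₁;
     star a₁ * star a₃ - c₂ * a₂, a₂ * a₃ - c₁ * star a₁, c₁ * c₂ - a₃ * star a₃]

/-- A Hermitian matrix has rank one if `h^# = 0` but `h ≠ 0`. -/
def IsRankOne {α β : ℚ} {R : Type*} [CommRing R] [Algebra ℚ R] (h : H3 α β R) : Prop :=
  sharp (h : Matrix (Fin 3) (Fin 3) (Quat α β R)) = 0 ∧ h ≠ 0

/-- A good basis of the order `O`: a `ℤ`-basis `1, v₁, v₂, v₃` of `O` together with integers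
`a, b, c` such that the associated Hermitian matrix is of rank one. -/
structure GoodBasis {α β : ℚ} (O : Subring (Quat α β ℚ)) where
  a : ℤ
  b : ℤ
  c : ℤ
  v₁ : Quat α β ℚ
  v₂ : Quat α β ℚ
  v₃ : Quat α β ℚ
  linearIndependent : LinearIndependent ℤ ![1, v₁, v₂, v₃]
  span_eq : Submodule.span ℤ (Set.range ![1, v₁, v₂, v₃]) =
    AddSubgroup.toIntSubmodule O.toAddSubgroup
  rankOne : IsRankOne (hermitian (R := ℚ) a b c v₁ v₂ v₃)

namespace GoodBasis

variable {α β : ℚ} {O : Subring (Quat α β ℚ)} (G : GoodBasis O)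

/-- The Hermitian matrix `A(T)`, as an element of `H_3(B ⊗ R)`. -/
def A (R : Type*) [CommRing R] [Algebra ℚ R] : H3 α β R :=
  hermitian (algebraMap ℚ R G.a) (algebraMap ℚ R G.b) (algebraMap ℚ R G.c)
    (Quat.base R G.v₁) (Quat.base R G.v₂) (Quat.base R G.v₃)

/-- The half-integral symmetric matrix `T`. -/
def T : Matrix (Fin 3) (Fin 3) ℚ :=
  !![(G.a : ℚ), Quat.tr G.v₃ / 2, Quat.tr G.v₂ / 2;
     Quat.tr G.v₃ / 2, (G.b : ℚ), Quat.tr G.v₁ / 2;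
     Quat.tr G.v₂ / 2, Quat.tr G.v₁ / 2, (G.c : ℚ)]

end GoodBasis

/-! ### Freudenthal's space and its embedding in `⋀³ W₆ ⊗ B` -/

/-- `W(R) = R ⊕ H_3(B ⊗ R) ⊕ H_3(B ⊗ R) ⊕ R`. -/
structure W (α β : ℚ) (R : Type*) [CommRing R] [Algebra ℚ R] where
  a : R
  b : H3 α β R
  c : H3 α β R
  d : R

/-- `f_O = (0, 0, A(T), 0)` in `W(R)`. -/
def GoodBasis.fO {α β : ℚ} {O : Subring (Quat α β ℚ)} (G : GoodBasis O)
    (R : Type*) [CommRing R] [Algebra ℚ R] : W α β R :=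
  ⟨0, 0, G.A R, 0⟩

/-- The defining representation `W₆` of `GSp_6` (row vectors). -/
abbrev W6 (R : Type*) : Type _ := Fin 3 ⊕ Fin 3 → R

/-- The first half `e₁, e₂, e₃` of the symplectic basis of `W₆` (indexed from `0`). -/
def e (R : Type*) [CommRing R] (i : Fin 3) : W6 R := Pi.single (Sum.inl i) 1

/-- The second half `f₁, f₂, f₃` of the symplectic basis of `W₆` (indexed from `0`). -/
def f (R : Type*) [CommRing R] (i : Fin 3) : W6 R := Pi.single (Sum.inr i) 1

/-- `⋀³ W₆ ⊗ B` over `R`. -/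
abbrev Tri (α β : ℚ) (R : Type*) [CommRing R] [Algebra ℚ R] : Type _ :=
  (⋀[R]^3 (W6 R)) ⊗[R] (Quat α β R)

/-- The wedge product of three vectors of `W₆`. -/
def wedge {R : Type*} [CommRing R] (x y z : W6 R) : ⋀[R]^3 (W6 R) :=
  exteriorPower.ιMulti R 3 ![x, y, z]

/-- The embedding of `W` in `⋀³ W₆ ⊗ B`, which sends `(a, b, c, d)` to
`a e₁ ∧ e₂ ∧ e₃ + ∑ b_ij e_i^* ∧ f_j + ∑ c_ij f_i^* ∧ e_j + d f₁ ∧ f₂ ∧ f₃`, where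
`e_i^* = e_{i+1} ∧ e_{i+2}` and `f_i^* = f_{i+1} ∧ f_{i+2}` with indices modulo `3`. -/
def W.toTri {α β : ℚ} {R : Type*} [CommRing R] [Algebra ℚ R] (w : W α β R) : Tri α β R :=
  wedge (e R 0) (e R 1) (e R 2) ⊗ₜ[R] algebraMap R (Quat α β R) w.a
  + ∑ i : Fin 3, ∑ j : Fin 3,
      wedge (e R (i + 1)) (e R (i + 2)) (f R j) ⊗ₜ[R]
        (w.b : Matrix (Fin 3) (Fin 3) (Quat α β R)) i j
  + ∑ i : Fin 3, ∑ j : Fin 3,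
      wedge (f R (i + 1)) (f R (i + 2)) (e R j) ⊗ₜ[R]
        (w.c : Matrix (Fin 3) (Fin 3) (Quat α β R)) i j
  + wedge (f R 0) (f R 1) (f R 2) ⊗ₜ[R] algebraMap R (Quat α β R) w.d

/-! ### The group `GSp_6` and its right action -/

/-- The symplectic matrix `J₆`. -/
def J6 (R : Type*) [CommRing R] : Matrix (Fin 3 ⊕ Fin 3) (Fin 3 ⊕ Fin 3) R :=
  Matrix.fromBlocks 0 1 (-1) 0

/-- `GSp_6(R)`: pairs `(g, ν)` with `g J₆ ᵗg = ν J₆`, where `ν` is the similitude of `g`. -/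
def GSp6 (R : Type*) [CommRing R] : Subgroup (GL (Fin 3 ⊕ Fin 3) R × Rˣ) where
  carrier := {g | (g.1 : Matrix (Fin 3 ⊕ Fin 3) (Fin 3 ⊕ Fin 3) R) * J6 R *
    (g.1 : Matrix (Fin 3 ⊕ Fin 3) (Fin 3 ⊕ Fin 3) R)ᵀ = (g.2 : R) • J6 R}
  one_mem' := by simp
  mul_mem' := by
    rintro ⟨g, x⟩ ⟨h, y⟩ hg hh
    simp only [Set.mem_ofPred_eq, Prod.mk_mul_mk, Units.val_mul, Matrix.transpose_mul] at *
    calc _ = (g : Matrix (Fin 3 ⊕ Fin 3) (Fin 3 ⊕ Fin 3) R) * (h.val * J6 R * h.valᵀ) *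
          g.valᵀ := by simp only [Matrix.mul_assoc]
      _ = _ := by rw [hh, Matrix.mul_smul, Matrix.smul_mul, hg, smul_smul, mul_comm]
  inv_mem' := by
    rintro ⟨g, x⟩ hg
    simp only [Set.mem_ofPred_eq, Prod.inv_mk] at *
    have h1 : (g⁻¹).val * g.val = 1 := by simp
    have h2 : g.valᵀ * (g⁻¹).valᵀ = 1 := by rw [← Matrix.transpose_mul, h1, Matrix.transpose_one]
    have h3 : J6 R = (x : R) • ((g⁻¹).val * J6 R * (g⁻¹).valᵀ) := by
      rw [← Matrix.smul_mul, ← Matrix.mul_smul, ← hg]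
      simp only [Matrix.mul_assoc]
      rw [h2, Matrix.mul_one, ← Matrix.mul_assoc, h1, Matrix.one_mul]
    conv_rhs => rw [h3, smul_smul, Units.inv_mul, one_smul]

section

variable {R : Type*} [CommRing R]

/-- The underlying matrix. -/
def mat (g : GSp6 R) : Matrix (Fin 3 ⊕ Fin 3) (Fin 3 ⊕ Fin 3) R := g.1.1.val

/-- The similitude. -/
def nu (g : GSp6 R) : Rˣ := g.1.2

theorem mat_mul (g h : GSp6 R) : mat (g * h) = mat g * mat h := rfl

theorem mat_mul_J6 (g : GSp6 R) : mat g * J6 R * (mat g)ᵀ = (nu g : R) • J6 R := g.2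

theorem mat_one : mat (1 : GSp6 R) = 1 := rfl

theorem ext_mat {g h : GSp6 R} (hm : mat g = mat h) : g = h := by
  have h1 : g.1.1 = h.1.1 := Units.ext hm
  have h2 : (nu g : R) • J6 R = (nu h : R) • J6 R := by
    rw [← mat_mul_J6, ← mat_mul_J6, hm]
  have h3 := congrFun (congrFun h2 (Sum.inl 0)) (Sum.inr 0)
  have h4 : (nu g : R) = nu h := by simpa [J6] using h3
  exact Subtype.ext (Prod.ext h1 (Units.ext h4))

/-- The right action of `GSp_6` on `(⋀³ W₆ ⊗ ν⁻¹) ⊗ B`, through the right action on row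
vectors. -/
def act {α β : ℚ} {R : Type*} [CommRing R] [Algebra ℚ R] (w : Tri α β R) (g : GSp6 R) :
    Tri α β R :=
  (((nu g)⁻¹ : Rˣ) : R) •
    (exteriorPower.map 3 (Matrix.vecMulLinear (mat g))).rTensor (Quat α β R) w

end

/-- The element `(λ, m)` of `GSp_6`: the block diagonal matrix with blocks `λ det(m) ᵗm⁻¹`
and `m`; its similitude is `λ det(m)`. -/
def levi {R : Type*} [CommRing R] (l : Rˣ) (m : GL (Fin 3) R) : GSp6 R :=
  ⟨(⟨Matrix.fromBlocks
        (((l * Matrix.GeneralLinearGroup.det m : Rˣ) : R) • (m⁻¹).valᵀ) 0 0 m.val,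
      Matrix.fromBlocks
        ((((l * Matrix.GeneralLinearGroup.det m)⁻¹ : Rˣ) : R) • m.valᵀ) 0 0 (m⁻¹).val,
      by
        rw [Matrix.fromBlocks_multiply]
        simp only [Matrix.smul_mul, Matrix.mul_smul, smul_smul,
          ← Matrix.transpose_mul, ← Units.val_mul, mul_inv_cancel]
        simp,
      by
        rw [Matrix.fromBlocks_multiply]
        simp only [Matrix.smul_mul, Matrix.mul_smul, smul_smul,
          ← Matrix.transpose_mul, ← Units.val_mul, inv_mul_cancel]
        simp⟩,
    l * Matrix.GeneralLinearGroup.det m), by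
    change Matrix.fromBlocks _ _ _ _ * J6 R * (Matrix.fromBlocks _ _ _ _)ᵀ = _ • J6 R
    rw [J6, Matrix.fromBlocks_transpose, Matrix.fromBlocks_multiply, Matrix.fromBlocks_multiply,
      Matrix.fromBlocks_smul]
    have h1 : (m⁻¹).valᵀ * m.valᵀ = 1 := by
      rw [← Matrix.transpose_mul, ← Units.val_mul, mul_inv_cancel]; simp
    have h2 : m.val * (m⁻¹).val = 1 := by rw [← Units.val_mul, mul_inv_cancel]; simp
    simp only [Matrix.coe_units_inv] at h1 h2
    simp [h1, h2]⟩

/-- The unipotent radical `U_P` of the Siegel parabolic: the elements with matrix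
`(1 u; 0 1)`, `u` symmetric. -/
def UP (R : Type*) [CommRing R] : Subgroup (GSp6 R) where
  carrier := {g | ∃ u : Matrix (Fin 3) (Fin 3) R, uᵀ = u ∧ mat g = Matrix.fromBlocks 1 u 0 1}
  one_mem' := ⟨0, by simp, by simp [mat_one]⟩
  mul_mem' := by
    rintro g h ⟨u, hu, hg⟩ ⟨w, hw, hh⟩
    refine ⟨u + w, by simp [hu, hw], ?_⟩
    rw [mat_mul, hg, hh, Matrix.fromBlocks_multiply]
    simp [add_comm]
  inv_mem' := by
    rintro g ⟨u, hu, hg⟩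
    refine ⟨-u, by simp [hu], ?_⟩
    have h1 : mat g * mat g⁻¹ = 1 := by rw [← mat_mul, mul_inv_cancel, mat_one]
    have h2 : Matrix.fromBlocks 1 (-u) 0 1 * mat g = 1 := by
      rw [hg, Matrix.fromBlocks_multiply]; simp
    exact (left_inv_eq_right_inv h2 h1).symm

/-- The symmetric matrix `u` of an element `(1 u; 0 1)` of `U_P`. -/
def sym {R : Type*} [CommRing R] (u : UP R) : Matrix (Fin 3) (Fin 3) R :=
  (mat (u : GSp6 R)).toBlocks₁₂

theorem mat_UP {R : Type*} [CommRing R] (u : UP R) :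
    mat (u : GSp6 R) = Matrix.fromBlocks 1 (sym u) 0 1 := by
  obtain ⟨w, -, hw⟩ := u.2
  rw [sym, hw, Matrix.toBlocks_fromBlocks₁₂]

theorem sym_one {R : Type*} [CommRing R] : sym (1 : UP R) = 0 := by
  ext i j
  simp [sym, mat_one, Matrix.toBlocks₁₂]

theorem sym_mul {R : Type*} [CommRing R] (u w : UP R) : sym (u * w) = sym u + sym w := by
  have h : mat ((u * w : UP R) : GSp6 R) = mat (u : GSp6 R) * mat (w : GSp6 R) := rfl
  rw [sym, h, mat_UP, mat_UP, Matrix.fromBlocks_multiply, Matrix.toBlocks_fromBlocks₁₂]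
  simp [add_comm]

theorem ext_sym {R : Type*} [CommRing R] {u w : UP R} (h : sym u = sym w) : u = w :=
  Subtype.ext (ext_mat (by rw [mat_UP, mat_UP, h]))

theorem UP_mul_comm {R : Type*} [CommRing R] (u w : UP R) : u * w = w * u :=
  ext_sym (by rw [sym_mul, sym_mul, add_comm])

/-- `tr(Tu)` for a rational matrix `T` and an element `(1 u; 0 1)` of `U_P`. -/
def trT {R : Type*} [CommRing R] [Algebra ℚ R] (T : Matrix (Fin 3) (Fin 3) ℚ) (u : UP R) : R :=
  (T.map (algebraMap ℚ R) * sym u).trace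

theorem trT_one {R : Type*} [CommRing R] [Algebra ℚ R] (T : Matrix (Fin 3) (Fin 3) ℚ) :
    trT T (1 : UP R) = 0 := by
  simp [trT, sym_one]

theorem trT_mul {R : Type*} [CommRing R] [Algebra ℚ R] (T : Matrix (Fin 3) (Fin 3) ℚ)
    (u w : UP R) : trT T (u * w) = trT T u + trT T w := by
  simp [trT, sym_mul, Matrix.mul_add]

/-- The subgroup `U_0` of `U_P` of the elements with `tr(Tu) = 0`. -/
def U0 (R : Type*) [CommRing R] [Algebra ℚ R] (T : Matrix (Fin 3) (Fin 3) ℚ) :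
    Subgroup (UP R) where
  carrier := {u | trT T u = 0}
  one_mem' := trT_one T
  mul_mem' := by
    intro u w hu hw
    simp only [Set.mem_ofPred_eq] at *
    rw [trT_mul, hu, hw, add_zero]
  inv_mem' := by
    intro u hu
    simp only [Set.mem_ofPred_eq] at *
    have h := trT_mul T u u⁻¹
    rw [mul_inv_cancel, trT_one, hu, zero_add] at h
    exact h.symm

/-- `U_P` is commutative, so `U_0` is normal; left and right cosets agree. -/
instance U0.normal (R : Type*) [CommRing R] [Algebra ℚ R] (T : Matrix (Fin 3) (Fin 3) ℚ) :
    (U0 R T).Normal :=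
  ⟨fun u hu g => by rwa [UP_mul_comm g u, mul_inv_cancel_right]⟩

/-- The character `χ(u) = ψ(tr(Tu))` of `U_P(𝔸_f)`. -/
def chi (T : Matrix (Fin 3) (Fin 3) ℚ) (u : UP Af) : ℂ := psi (trT T u)

/-! ### The Schwartz-Bruhat function and `Ξ` -/

/-- `O ⊗ ℤ̂` inside `B ⊗ 𝔸_f`. -/
def orderHat {α β : ℚ} (O : Subring (Quat α β ℚ)) : Submodule Zhat (Quat α β Af) :=
  Submodule.span Zhat (Quat.base Af '' (O : Set (Quat α β ℚ)))

/-- `J_0 ⊗ ℤ̂`: Hermitian matrices with diagonal entries in `ℤ̂` and off-diagonal entries in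
`O ⊗ ℤ̂`. -/
def J0Hat {α β : ℚ} (O : Subring (Quat α β ℚ)) : Set (H3 α β Af) :=
  {h | ∃ c₁ ∈ Zhat, ∃ c₂ ∈ Zhat, ∃ c₃ ∈ Zhat,
    ∃ x₁ ∈ orderHat O, ∃ x₂ ∈ orderHat O, ∃ x₃ ∈ orderHat O,
      h = hermitian c₁ c₂ c₃ x₁ x₂ x₃}

/-- `W(ℤ̂) = ∏_p W(ℤ_p)`. -/
def WHat {α β : ℚ} (O : Subring (Quat α β ℚ)) : Set (W α β Af) :=
  {w | w.a ∈ Zhat ∧ w.b ∈ J0Hat O ∧ w.c ∈ J0Hat O ∧ w.d ∈ Zhat}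

/-- `Φ_f`, the characteristic function of `W(ℤ̂)`, where `W` is identified with its image in
`⋀³ W₆ ⊗ B`. -/
def PhiF {α β : ℚ} (O : Subring (Quat α β ℚ)) : Tri α β Af → ℂ :=
  (W.toTri '' WHat O).indicator 1

/-- A symmetric matrix over `𝔸_f` is half-integral: its diagonal entries and the doubles of its
off-diagonal entries lie in `ℤ̂`. -/
def IsHalfIntegral (S : Matrix (Fin 3) (Fin 3) Af) : Prop :=
  Sᵀ = S ∧ (∀ i, S i i ∈ Zhat) ∧ ∀ i j, i ≠ j → 2 * S i j ∈ Zhat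

/-- `m⁻¹ T c(m)`, where `c(m) = det(m) ᵗm⁻¹` is the cofactor matrix of `m`. -/
def twist (T : Matrix (Fin 3) (Fin 3) ℚ) (m : GL (Fin 3) Af) : Matrix (Fin 3) (Fin 3) Af :=
  (m⁻¹).val * T.map (algebraMap ℚ Af) * (m.val.det • (m⁻¹).valᵀ)

open Classical in
/-- `Ξ(λ, m)` is `1` if `λ ∈ ℤ̂`, `m ∈ M_3(ℤ̂)` and `m⁻¹ T c(m)` is half-integral, and `0`
otherwise. -/
def Xi (T : Matrix (Fin 3) (Fin 3) ℚ) (l : Afˣ) (m : GL (Fin 3) Af) : ℂ :=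
  if (l : Af) ∈ Zhat ∧ (∀ i j, m.val i j ∈ Zhat) ∧ IsHalfIntegral (twist T m) then 1 else 0

end SpinGSp6

end

open SpinGSp6

noncomputable section

namespace SpinGSp6

open IsDedekindDomain HeightOneSpectrum

/-! ### Finite adeles of `ℚ` -/

/-! Acting on `f_O` by `u (λ, m)` gives `(0, 0, C, λ⁻¹ tr(Tu))` with `C = det(m) m⁻¹ A(T) ᵗm⁻¹`
(`act_fO`). The integrand is therefore the product of a condition on `m` alone, `C ∈ J0Hat`, and of
a function of `t = tr(Tu)` alone, `ψ(t)` times the indicator of `t ∈ λẐ`.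

The integral over `t` is elementary. Up to a unit of `Ẑ`, `λ` is a positive rational `q` with `|λ|_f
= q⁻¹`, and translation invariance gives the preimage of `qẐ` the measure `q⁻¹` (`measure_level`).
If `λ` is integral then `ψ = 1` there; otherwise `ψ` is a nontrivial character of `qẐ` and the
integral vanishes (`integral_indicator_level`). This needs `u ↦ tr(Tu)` to be onto, hence `T ≠ 0`
(`GoodBasis.T_ne_zero`).

The condition on `C` is the arithmetic core (`hermTwist_mem_J0Hat_iff`). The real part of `C` is
`m⁻¹ T c(m)`. The imaginary part of `A(T)` is antisymmetric, and congruence acts on antisymmetric `3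
× 3` matrices through cofactors, so an off-diagonal entry of `C` is `s + ∑ m_ki v_k` for a scalar
`s`. In a good basis, integrality of these entries forces that of `m`, and traces give
half-integrality. Conversely only `s` is in doubt. Congruence preserves rank one, so `n(C_kl) = C_kk
C_ll` (`nrm_hermTwist`); this is a monic quadratic equation for `s` with integral coefficients, and
`Ẑ` is integrally closed (`mem_Zhat_of_quadratic`). -/

theorem mem_Zhat_iff {x : Af} : x ∈ Zhat ↔ ∀ v, Valued.v (x v) ≤ 1 := Iff.rfl

theorem Af.mul_apply (x y : Af) (v : HeightOneSpectrum ℤ) : (x * y) v = x v * y v := rfl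

theorem Af.add_apply (x y : Af) (v : HeightOneSpectrum ℤ) : (x + y) v = x v + y v := rfl

theorem Af.sub_apply (x y : Af) (v : HeightOneSpectrum ℤ) : (x - y) v = x v - y v := rfl

theorem Af.one_apply (v : HeightOneSpectrum ℤ) : (1 : Af) v = 1 := rfl

theorem valued_algebraMap (q : ℚ) (v : HeightOneSpectrum ℤ) :
    Valued.v (algebraMap ℚ Af q v) = v.valuation ℚ q := by
  rw [FiniteAdeleRing.algebraMap_apply]
  exact valuedAdicCompletion_eq_valuation' v q

theorem intCast_mem_Zhat (n : ℤ) : algebraMap ℚ Af n ∈ Zhat := by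
  rw [map_intCast]; exact intCast_mem Zhat n

theorem algebraMap_mem_Zhat_iff {q : ℚ} : algebraMap ℚ Af q ∈ Zhat ↔ ∃ n : ℤ, q = n := by
  constructor
  · intro h
    obtain ⟨n, hn⟩ := mem_integers_of_valuation_le_one (R := ℤ) ℚ q fun v => by
      rw [← valued_algebraMap]; exact h v
    exact ⟨n, by simpa using hn.symm⟩
  · rintro ⟨n, rfl⟩
    exact intCast_mem_Zhat n

/-- The positive generator of the prime ideal at a finite place of `ℚ`. -/
def prm (v : HeightOneSpectrum ℤ) : ℕ := Ideal.absNorm v.asIdeal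

theorem span_prm (v : HeightOneSpectrum ℤ) : v.asIdeal = Ideal.span {(prm v : ℤ)} :=
  (Int.ideal_span_absNorm_eq_self v.asIdeal).symm

theorem prime_prm (v : HeightOneSpectrum ℤ) : (prm v).Prime := by
  rw [Nat.prime_iff_prime_int, ← Ideal.span_singleton_prime, ← span_prm]
  · exact v.isPrime
  · intro h
    exact v.ne_bot (by rw [span_prm, h]; simp)

theorem prm_injective : Function.Injective prm := fun v w h =>
  HeightOneSpectrum.ext (by rw [span_prm, span_prm w, h])

theorem valuation_prm_self (v : HeightOneSpectrum ℤ) :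
    v.valuation ℚ (prm v : ℚ) = WithZero.exp (-1 : ℤ) := by
  have h := valuation_of_algebraMap (K := ℚ) v (prm v : ℤ)
  rw [intValuation_singleton v (by exact_mod_cast (prime_prm v).ne_zero) (span_prm v)] at h
  simpa using h

theorem valuation_natCast_eq_one {v : HeightOneSpectrum ℤ} {n : ℕ} (h : ¬ prm v ∣ n) :
    v.valuation ℚ (n : ℚ) = 1 := by
  have h' := valuation_of_algebraMap (K := ℚ) v (n : ℤ)
  rw [intValuation_eq_one_iff.2 (by
    rw [span_prm, Ideal.mem_span_singleton]; exact_mod_cast h)] at h'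
  simpa using h'

theorem valuation_prm_of_ne {v w : HeightOneSpectrum ℤ} (h : v ≠ w) :
    v.valuation ℚ (prm w : ℚ) = 1 := by
  refine valuation_natCast_eq_one fun hd => h (prm_injective ?_)
  exact (Nat.prime_dvd_prime_iff_eq (prime_prm v) (prime_prm w)).1 hd

theorem localAbs_eq {v : HeightOneSpectrum ℤ} {x : v.adicCompletion ℚ} (hx : Valued.v x ≠ 0) :
    localAbs v x = (prm v : ℝ) ^ WithZero.log (Valued.v x) := by
  rw [localAbs, WithZeroMulInt.toNNReal_neg_apply _ hx, NNReal.coe_zpow,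
    WithZero.toAdd_unzero_eq_log]
  rfl

/-- Up to a unit of `ℤ̂`, every finite idele is a positive rational number, and its absolute value
is the inverse of that number. -/
theorem exists_rat_generator (l : Afˣ) : ∃ q : ℚ, 0 < q ∧
    (∀ v, Valued.v ((l : Af) v) = v.valuation ℚ q) ∧ finiteAbs l = ((q⁻¹ : ℚ) : ℝ) := by
  obtain ⟨h0, hfin⟩ := FiniteAdeleRing.isUnit_iff.1 l.isUnit
  have hfin' : {v | Valued.v ((l : Af) v) ≠ 1}.Finite := hfin
  have hv0 : ∀ v, Valued.v ((l : Af) v) ≠ 0 := fun v => (Valuation.ne_zero_iff _).2 (h0 v)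
  set S := hfin'.toFinset with hS
  set n : HeightOneSpectrum ℤ → ℤ := fun v => WithZero.log (Valued.v ((l : Af) v)) with hn
  have hp : ∀ v, (0 : ℚ) < prm v := fun v => by exact_mod_cast (prime_prm v).pos
  -- The valuation of a uniformizer is `exp (-1)`, so `-n w` is the order of `l` at `w`.
  refine ⟨∏ w ∈ S, (prm w : ℚ) ^ (-n w), Finset.prod_pos fun w _ => zpow_pos (hp w) _, ?_, ?_⟩
  · intro v
    rw [map_prod]
    by_cases hv : v ∈ S
    · rw [Finset.prod_eq_single_of_mem v hv]
      · rw [map_zpow₀, valuation_prm_self, ← WithZero.exp_zsmul]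
        simp [hn, WithZero.exp_log (hv0 v)]
      · intro w _ hw
        rw [map_zpow₀, valuation_prm_of_ne hw.symm, one_zpow]
    · rw [Finset.prod_eq_one]
      · simpa [hS] using hv
      · intro w hw
        rw [map_zpow₀, valuation_prm_of_ne (by rintro rfl; exact hv hw), one_zpow]
  · rw [finiteAbs, finprod_eq_prod_of_mulSupport_subset (s := S)]
    · push_cast
      rw [← Finset.prod_inv_distrib]
      refine Finset.prod_congr rfl fun v _ => ?_
      rw [localAbs_eq (hv0 v), zpow_neg, inv_inv]
    · intro v hv
      rw [Function.mem_mulSupport, localAbs_eq (hv0 v)] at hv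
      simp only [hS, Set.Finite.coe_toFinset, Set.mem_ofPred_eq]
      intro h
      exact hv (by rw [h]; simp)

open Classical in
/-- Every finite adele is integral up to a positive integer factor. -/
theorem exists_nat_mul_mem_Zhat (x : Af) : ∃ N : ℕ, 0 < N ∧ algebraMap ℚ Af N * x ∈ Zhat := by
  have hfin : {v | ¬ x v ∈ v.adicCompletionIntegers ℚ}.Finite := x.2
  choose b hb0 hb using fun v => adicCompletion.mul_nonZeroDivisor_mem_adicCompletionIntegers
    (K := ℚ) v (x v)
  have hint : ∀ (v : HeightOneSpectrum ℤ) (n : ℤ), v.valuation ℚ (n : ℚ) ≤ 1 := fun v n => by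
    simpa using v.valuation_le_one (K := ℚ) n
  refine ⟨∏ w ∈ hfin.toFinset, (b w).natAbs, Finset.prod_pos fun w _ =>
    Int.natAbs_pos.2 (nonZeroDivisors.ne_zero (hb0 w)), fun v => ?_⟩
  rw [mem_adicCompletionIntegers, Af.mul_apply, map_mul, valued_algebraMap]
  by_cases hv : v ∈ hfin.toFinset
  · rw [← Finset.mul_prod_erase _ _ hv]
    push_cast
    rw [map_mul]
    have h1 := hb v
    rw [mem_adicCompletionIntegers, map_mul, valuedAdicCompletion_eq_valuation,
      valuation_of_algebraMap] at h1
    have h2 : v.valuation ℚ ((b v).natAbs : ℚ) = v.intValuation (b v) := by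
      rw [Nat.cast_natAbs, Int.cast_abs]
      rw [← valuation_of_algebraMap (K := ℚ)]
      rcases abs_choice (b v : ℚ) with h | h <;> rw [h] <;> simp
    rw [h2, mul_right_comm, mul_comm (v.intValuation _)]
    refine mul_le_one' h1 ?_
    rw [map_prod]
    exact Finset.prod_le_one' fun w _ => by simpa using hint v ((b w).natAbs : ℤ)
  · refine mul_le_one' (by exact_mod_cast hint v _) ?_
    simpa [mem_adicCompletionIntegers] using hv

/-- `ℚ` is dense in `ℚ_p`, and a `p`-integral rational is congruent to an integer modulo `p`. This
handles the place `p`; at every other place `p` is a unit and imposes no condition. -/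
theorem exists_int_add_prime_mul {p : ℕ} (hp : p.Prime) {x : Af} (hx : x ∈ Zhat) :
    ∃ k : ℤ, ∃ z ∈ Zhat, x = algebraMap ℚ Af k + algebraMap ℚ Af p * z := by
  have hI : Prime (Ideal.span {(p : ℤ)}) := by
    rw [Ideal.prime_span_singleton_iff]
    exact Nat.prime_iff_prime_int.1 hp
  set v : HeightOneSpectrum ℤ := .ofPrime hI with hv
  have hvp : prm v = p := by
    simp [prm, hv]
  obtain ⟨q, hq⟩ : ∃ q : ℚ, Valued.v (x v - algebraMap ℚ Af q v) < 1 := by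
    have h := (denseRange_algebraMap (R := ℤ) ℚ v).exists_mem_open
      (s := {y | Valued.v (x v - y) < 1}) ?_ ⟨x v, by simp⟩
    · obtain ⟨q, hq⟩ := h
      exact ⟨q, hq⟩
    · have h1 : IsOpen {y : v.adicCompletion ℚ | Valued.v y < (1 : WithZero (Multiplicative ℤ))} := by
        simp only [← Valued.v.restrict_lt_one_iff]
        exact Valued.isOpen_ball _ _
      exact h1.preimage (continuous_const.sub continuous_id)
  have hq1 : v.valuation ℚ q ≤ 1 := by
    rw [← valued_algebraMap, ← sub_sub_cancel (x v) (algebraMap ℚ Af q v)]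
    exact (Valuation.map_sub _ _ _).trans (max_le (hx v) hq.le)
  obtain ⟨k, hk⟩ := v.exists_valuation_sub_lt_of_integer (K := ℚ) hq1 1
  have hp0 : (p : ℚ) ≠ 0 := by exact_mod_cast hp.ne_zero
  have hxk : Valued.v (x v - algebraMap ℚ Af k v) < 1 := by
    rw [← sub_add_sub_cancel _ (algebraMap ℚ Af q v)]
    refine (Valuation.map_add _ _ _).trans_lt (max_lt hq ?_)
    rw [← Af.sub_apply, ← map_sub, valued_algebraMap, Valuation.map_sub_swap]
    simpa using hk
  refine ⟨k, algebraMap ℚ Af (p : ℚ)⁻¹ * (x - algebraMap ℚ Af k), fun w => ?_, ?_⟩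
  · rw [mem_adicCompletionIntegers, Af.mul_apply, map_mul, valued_algebraMap, map_inv₀]
    by_cases hw : w = v
    · subst hw
      rw [← hvp, valuation_prm_self, Af.sub_apply]
      -- The value group is discrete: a valuation below `1` is at most `exp (-1)`.
      have : Valued.v (x v - algebraMap ℚ Af k v) ≤ WithZero.exp (-1 : ℤ) := by
        rw [← WithZero.lt_mul_exp_iff_le WithZero.exp_ne_zero, ← WithZero.exp_add]
        simpa using hxk
      exact inv_mul_le_one_of_le₀ this zero_le
    · rw [← hvp, valuation_prm_of_ne hw, inv_one, one_mul]
      exact (sub_mem hx (intCast_mem_Zhat k)) w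
  · rw [← mul_assoc, ← map_mul, mul_inv_cancel₀ hp0, map_one, one_mul, add_sub_cancel]

theorem exists_int_add_mul {n : ℕ} (hn : n ≠ 0) {x : Af} (hx : x ∈ Zhat) :
    ∃ k : ℤ, ∃ z ∈ Zhat, x = algebraMap ℚ Af k + algebraMap ℚ Af n * z := by
  induction n using Nat.recOnMul generalizing x with
  | zero => exact absurd rfl hn
  | one => exact ⟨0, x, hx, by simp⟩
  | prime p hp => exact exists_int_add_prime_mul hp hx
  | mul a b ha hb =>
    obtain ⟨k, z, hz, rfl⟩ := ha (left_ne_zero_of_mul hn) hx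
    obtain ⟨k', z', hz', rfl⟩ := hb (right_ne_zero_of_mul hn) hz
    exact ⟨k + a * k', z', hz', by
      simp only [Int.cast_add, Int.cast_mul, Nat.cast_mul, Int.cast_natCast, map_add, map_mul]
      ring⟩

/-- `𝔸_f = ℚ + ℤ̂`. -/
theorem exists_rat_sub_mem_Zhat (x : Af) : ∃ q : ℚ, x - algebraMap ℚ Af q ∈ Zhat := by
  obtain ⟨N, hN, hx⟩ := exists_nat_mul_mem_Zhat x
  obtain ⟨k, z, hz, h⟩ := exists_int_add_mul hN.ne' hx
  have hN0 : (N : ℚ) ≠ 0 := by exact_mod_cast hN.ne'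
  refine ⟨(N : ℚ)⁻¹ * k, ?_⟩
  have : x = algebraMap ℚ Af (N : ℚ)⁻¹ * (algebraMap ℚ Af N * x) := by
    rw [← mul_assoc, ← map_mul, inv_mul_cancel₀ hN0, map_one, one_mul]
  rw [this, h, mul_add, ← map_mul, add_sub_cancel_left, ← mul_assoc, ← map_mul,
    inv_mul_cancel₀ hN0, map_one, one_mul]
  exact hz

theorem isOpen_Zhat : IsOpen (Zhat : Set Af) := by
  exact RestrictedProduct.isOpen_forall_mem fun v => Valued.isOpen_valuationSubring _

/-! ### The additive character -/

/-- Two admissible rationals differ by an element of `ℚ ∩ Ẑ = ℤ`, which the exponential does not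
see. -/
theorem psi_eq {x : Af} {q : ℚ} (h : x - algebraMap ℚ Af q ∈ Zhat) :
    psi x = Complex.exp (-(2 * Real.pi * Complex.I * (q : ℂ))) := by
  have hex : ∃ q : ℚ, x - algebraMap ℚ Af q ∈ Zhat := ⟨q, h⟩
  rw [psi, dif_pos hex]
  have h' := sub_mem h hex.choose_spec
  rw [sub_sub_sub_cancel_left, ← map_sub, algebraMap_mem_Zhat_iff] at h'
  obtain ⟨n, hn⟩ := h'
  rw [Complex.exp_eq_exp_iff_exists_int]
  refine ⟨-n, ?_⟩
  have : (hex.choose : ℂ) = q + n := by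
    rw [sub_eq_iff_eq_add] at hn; rw [hn]; push_cast; ring
  rw [this]; push_cast; ring

theorem psi_add (x y : Af) : psi (x + y) = psi x * psi y := by
  obtain ⟨q, hq⟩ := exists_rat_sub_mem_Zhat x
  obtain ⟨r, hr⟩ := exists_rat_sub_mem_Zhat y
  have h : x + y - algebraMap ℚ Af (q + r) ∈ Zhat := by
    rw [map_add, add_sub_add_comm]; exact add_mem hq hr
  rw [psi_eq hq, psi_eq hr, psi_eq h, ← Complex.exp_add]
  congr 1; push_cast; ring

theorem psi_of_mem {x : Af} (hx : x ∈ Zhat) : psi x = 1 := by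
  rw [psi_eq (q := 0) (by simpa using hx)]; simp

theorem norm_psi (x : Af) : ‖psi x‖ = 1 := by
  obtain ⟨q, hq⟩ := exists_rat_sub_mem_Zhat x
  rw [psi_eq hq, Complex.norm_exp]
  simp

theorem psi_rat_ne_one {q : ℚ} (hq : algebraMap ℚ Af q ∉ Zhat) : psi (algebraMap ℚ Af q) ≠ 1 := by
  intro h
  rw [psi_eq (q := q) (by simp), Complex.exp_eq_one_iff] at h
  obtain ⟨n, hn⟩ := h
  refine hq (algebraMap_mem_Zhat_iff.2 ⟨-n, ?_⟩)
  have h2 : (2 * Real.pi * Complex.I : ℂ) ≠ 0 := Complex.two_pi_I_ne_zero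
  have h3 : (q : ℂ) = ((-n : ℤ) : ℂ) := by
    apply mul_left_cancel₀ h2
    push_cast
    linear_combination -hn
  exact_mod_cast h3

open MeasureTheory

theorem isOpen_mul_mem_Zhat (x : Af) : IsOpen {y : Af | x * y ∈ Zhat} :=
  isOpen_Zhat.preimage (continuous_const_mul x)

/-- `ψ` is constant on the cosets of the open subgroup `Ẑ`. -/
theorem continuous_psi : Continuous psi := by
  rw [continuous_iff_continuousAt]
  intro x
  refine (continuousAt_const (y := psi x)).congr ?_
  have hU : IsOpen {y : Af | y - x ∈ Zhat} := isOpen_Zhat.preimage (continuous_id.sub continuous_const)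
  filter_upwards [hU.mem_nhds (by simp : x - x ∈ Zhat)] with y hy
  rw [← add_sub_cancel x y, psi_add, psi_of_mem hy, mul_one]

/-! ### Integration over a group with a surjection to the finite adeles -/

/-- The preimage of the fractional ideal `q ℤ̂` under a map to the finite adeles. -/
def level {H : Type*} (τ : H → Af) (q : ℚ) : Set H := {x | algebraMap ℚ Af q⁻¹ * τ x ∈ Zhat}

theorem measurableSet_level {H : Type*} [TopologicalSpace H] [MeasurableSpace H] [BorelSpace H]
    {τ : H → Af} (hc : Continuous τ) (q : ℚ) :
    MeasurableSet (level τ q) := by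
  have h := ((isOpen_mul_mem_Zhat (algebraMap ℚ Af q⁻¹)).preimage hc).measurableSet
  exact h

section Integration

variable {H : Type*} [Group H]

/-- This is `qẐ = ⋃_{k<n} (kq + nqẐ)`, pulled back along `τ`. The cosets appear as preimages under
left translations, with the sign in `ht` chosen accordingly, so that left invariance of the measure
applies to them directly. -/
theorem level_eq_iUnion {τ : H → Af} (hτ : ∀ x y, τ (x * y) = τ x + τ y) {q : ℚ} (hq : q ≠ 0)
    {n : ℕ} (hn : n ≠ 0) {t : ℕ → H} (ht : ∀ k : ℕ, τ (t k) = -algebraMap ℚ Af (k * q)) :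
    level τ q = ⋃ k ∈ Finset.range n, (fun x => t k * x) ⁻¹' level τ (n * q) := by
  have hn0 : (n : ℚ) ≠ 0 := by exact_mod_cast hn
  have key : ∀ (k : ℕ) (x : H), algebraMap ℚ Af q⁻¹ * τ x =
      algebraMap ℚ Af k + algebraMap ℚ Af n * (algebraMap ℚ Af (n * q)⁻¹ * τ (t k * x)) := by
    intro k x
    rw [hτ, ht, ← mul_assoc, ← map_mul, mul_add, mul_neg, ← map_mul]
    have h1 : (n : ℚ) * (n * q)⁻¹ = q⁻¹ := by field_simp
    have h2 : q⁻¹ * (k * q) = k := by field_simp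
    rw [h1, h2]
    ring
  ext x
  simp only [Set.mem_iUnion, Finset.mem_range, Set.mem_preimage, exists_prop]
  constructor
  · intro hx
    obtain ⟨k, z, hz, h⟩ := exists_int_add_mul hn (show _ ∈ Zhat from hx)
    have hn' : (n : ℤ) ≠ 0 := by exact_mod_cast hn
    have hk : ((k % n).toNat : ℤ) = k % n := Int.toNat_of_nonneg (Int.emod_nonneg _ hn')
    -- The integer `k` is only determined modulo `n`; its reduction lies in `range n`, and the
    -- quotient `k / n` is absorbed into the integral part.
    refine ⟨(k % n).toNat, ?_, ?_⟩
    · have := Int.emod_lt_of_pos k (show (0 : ℤ) < n by positivity)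
      omega
    · have h3 := key (k % n).toNat x
      have h4 : (k : ℚ) = ((k % n).toNat : ℚ) + n * ((k / n : ℤ) : ℚ) := by
        rw [← Int.cast_natCast (k % n).toNat, hk]
        exact_mod_cast (Int.emod_add_mul_ediv k n).symm
      rw [h, h4, map_add, map_mul, add_assoc, ← mul_add, add_right_inj] at h3
      have h5 : IsUnit (algebraMap ℚ Af n) := (IsUnit.mk0 _ hn0).map _
      rw [level, Set.mem_ofPred_eq, ← h5.mul_left_cancel h3]
      exact add_mem (intCast_mem_Zhat _) hz
  · rintro ⟨k, -, hx⟩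
    rw [level, Set.mem_ofPred_eq, key k x]
    exact add_mem (by exact_mod_cast intCast_mem_Zhat k)
      (mul_mem (by exact_mod_cast intCast_mem_Zhat n) hx)

theorem pairwiseDisjoint_level {τ : H → Af} (hτ : ∀ x y, τ (x * y) = τ x + τ y) {q : ℚ}
    (hq : q ≠ 0) {n : ℕ} (hn : n ≠ 0) {t : ℕ → H}
    (ht : ∀ k : ℕ, τ (t k) = -algebraMap ℚ Af (k * q)) :
    (Finset.range n : Set ℕ).PairwiseDisjoint fun k => (fun x => t k * x) ⁻¹' level τ (n * q) := by
  have hn0 : (n : ℚ) ≠ 0 := by exact_mod_cast hn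
  intro k hk j hj hkj
  refine Set.disjoint_left.2 fun x hx hx' => hkj ?_
  have h := sub_mem (show _ ∈ Zhat from hx) (show _ ∈ Zhat from hx')
  rw [hτ, hτ, ht, ht, ← mul_sub, add_sub_add_right_eq_sub, neg_sub_neg, ← map_sub, ← map_mul,
    algebraMap_mem_Zhat_iff] at h
  obtain ⟨m, hm⟩ := h
  have h1 : ((j : ℤ) - k) = m * n := by
    have : ((j : ℚ) - k) = m * n := by rw [← hm]; field_simp
    exact_mod_cast this
  simp only [Finset.coe_range, Set.mem_Iio] at hk hj
  have h2 : ((j : ℤ) - k) = 0 := Int.eq_zero_of_abs_lt_dvd (Dvd.intro_left _ h1.symm)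
    (abs_lt.2 ⟨by omega, by omega⟩)
  omega

variable [TopologicalSpace H] [IsTopologicalGroup H] [MeasurableSpace H] [BorelSpace H]
  (μ : Measure H) [μ.IsMulLeftInvariant]

theorem measure_level_eq_nsmul {τ : H → Af} (hτ : ∀ x y, τ (x * y) = τ x + τ y)
    (hc : Continuous τ) (hs : Function.Surjective τ) {q : ℚ} (hq : q ≠ 0) {n : ℕ} (hn : n ≠ 0) :
    μ (level τ q) = n * μ (level τ (n * q)) := by
  choose t ht using fun k : ℕ => hs (-algebraMap ℚ Af (k * q))
  rw [level_eq_iUnion hτ hq hn ht, measure_biUnion_finset (pairwiseDisjoint_level hτ hq hn ht)]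
  · simp [measure_preimage_mul]
  · exact fun k _ => (measurable_const_mul (t k)) (measurableSet_level hc _)

theorem measure_level {τ : H → Af} (hτ : ∀ x y, τ (x * y) = τ x + τ y)
    (hc : Continuous τ) (hs : Function.Surjective τ) (h1 : μ (level τ 1) = 1) {q : ℚ}
    (hq : 0 < q) : μ (level τ q) = ENNReal.ofReal ((q⁻¹ : ℚ) : ℝ) := by
  have hd : (q.den : ℚ) ≠ 0 := by exact_mod_cast q.den_nz
  obtain ⟨a, ha⟩ := Int.eq_ofNat_of_zero_le (Rat.num_nonneg.2 hq.le)
  have hqa : q = a * (q.den : ℚ)⁻¹ := by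
    conv_lhs => rw [← Rat.num_div_den q, ha]
    rw [div_eq_mul_inv]; rfl
  have ha0 : a ≠ 0 := by rintro rfl; simp at hqa; exact hq.ne' hqa
  -- With `q = a / d`, the levels `1` and `a / d` are compared through the common larger level `1 /
  -- d`, in which they have index `d` and `a`.
  have e1 := measure_level_eq_nsmul μ hτ hc hs (inv_ne_zero hd) q.den_nz
  have e2 := measure_level_eq_nsmul μ hτ hc hs (inv_ne_zero hd) ha0
  rw [mul_inv_cancel₀ hd, h1, mul_one] at e1
  rw [← hqa, e1] at e2
  have ha0' : (a : ENNReal) ≠ 0 := by exact_mod_cast ha0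
  replace e2 := (ENNReal.eq_div_iff ha0' (by simp)).2 e2.symm
  have hinv : q⁻¹ = q.den / a := by
    conv_lhs => rw [hqa]
    rw [mul_inv, inv_inv, mul_comm, div_eq_mul_inv]
  have ha1 : (0 : ℝ) < a := by positivity
  rw [e2, hinv]
  push_cast
  rw [ENNReal.ofReal_div_of_pos ha1, ENNReal.ofReal_natCast, ENNReal.ofReal_natCast]

theorem integrable_indicator_level {τ : H → Af} (hτ : ∀ x y, τ (x * y) = τ x + τ y)
    (hc : Continuous τ) (hs : Function.Surjective τ) (h1 : μ (level τ 1) = 1) {q : ℚ}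
    (hq : 0 < q) : Integrable ((level τ q).indicator fun x => psi (τ x)) μ := by
  rw [integrable_indicator_iff (measurableSet_level hc q)]
  refine Measure.integrableOn_of_bounded (M := 1) ?_
    (continuous_psi.comp hc).aestronglyMeasurable (.of_forall fun x => (norm_psi _).le)
  rw [measure_level μ hτ hc hs h1 hq]
  exact ENNReal.ofReal_ne_top

open Classical in
theorem integral_indicator_level {τ : H → Af} (hτ : ∀ x y, τ (x * y) = τ x + τ y)
    (hc : Continuous τ) (hs : Function.Surjective τ) (h1 : μ (level τ 1) = 1) {q : ℚ}
    (hq : 0 < q) : ∫ x, (level τ q).indicator (fun x => psi (τ x)) x ∂μ =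
      if algebraMap ℚ Af q ∈ Zhat then (((q⁻¹ : ℚ) : ℝ) : ℂ) else 0 := by
  have hcancel : ∀ y : Af, algebraMap ℚ Af q * (algebraMap ℚ Af q⁻¹ * y) = y := fun y => by
    rw [← mul_assoc, ← map_mul, mul_inv_cancel₀ hq.ne', map_one, one_mul]
  split_ifs with hint
  · have : (level τ q).indicator (fun x => psi (τ x)) = (level τ q).indicator fun _ => (1 : ℂ) := by
      refine Set.indicator_congr fun x hx => psi_of_mem ?_
      rw [← hcancel (τ x)]
      exact mul_mem hint hx
    rw [this, integral_indicator_const _ (measurableSet_level hc q), measureReal_def,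
      measure_level μ hτ hc hs h1 hq, ENNReal.toReal_ofReal (by exact_mod_cast (inv_pos.2 hq).le)]
    simp
  -- Translation by `t` preserves the level set and multiplies the integrand by `ψ(q) ≠ 1`, so the
  -- integral is `0`.
  · obtain ⟨t, ht⟩ := hs (algebraMap ℚ Af q)
    have h2 := integral_mul_left_eq_self (μ := μ) ((level τ q).indicator fun x => psi (τ x)) t
    have h3 : ∀ x, (level τ q).indicator (fun x => psi (τ x)) (t * x) =
        psi (algebraMap ℚ Af q) * (level τ q).indicator (fun x => psi (τ x)) x := by
      intro x
      have h4 : t * x ∈ level τ q ↔ x ∈ level τ q := by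
        simp only [level, Set.mem_ofPred_eq]
        rw [hτ, ht, mul_add, ← map_mul, inv_mul_cancel₀ hq.ne', map_one,
          add_mem_cancel_left (one_mem _)]
      by_cases hx : x ∈ level τ q
      · rw [Set.indicator_of_mem hx, Set.indicator_of_mem (h4.2 hx), hτ, ht, psi_add]
      · rw [Set.indicator_of_notMem hx, Set.indicator_of_notMem (mt h4.1 hx), mul_zero]
    simp_rw [h3] at h2
    rw [integral_const_mul, mul_left_eq_self₀] at h2
    exact h2.resolve_left (psi_rat_ne_one hint)

end Integration

/-! ### The action on the image of Freudenthal's space -/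

section Wedge

variable {R : Type*} [CommRing R]

theorem update_vec₀ {M : Type*} (x y z t : M) :
    Function.update ![x, y, z] 0 t = ![t, y, z] := by
  ext i; fin_cases i <;> rfl

theorem update_vec₁ {M : Type*} (x y z t : M) :
    Function.update ![x, y, z] 1 t = ![x, t, z] := by
  ext i; fin_cases i <;> rfl

theorem update_vec₂ {M : Type*} (x y z t : M) :
    Function.update ![x, y, z] 2 t = ![x, y, t] := by
  ext i; fin_cases i <;> rfl

theorem wedge_add_left (x x' y z : W6 R) : wedge (x + x') y z = wedge x y z + wedge x' y z := by
  simpa only [wedge, update_vec₀] using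
    (exteriorPower.ιMulti R 3).map_update_add ![x, y, z] 0 x x'

theorem wedge_smul_left (r : R) (x y z : W6 R) : wedge (r • x) y z = r • wedge x y z := by
  simpa only [wedge, update_vec₀] using
    (exteriorPower.ιMulti R 3).map_update_smul ![x, y, z] 0 r x

theorem wedge_add_right (x y z z' : W6 R) : wedge x y (z + z') = wedge x y z + wedge x y z' := by
  simpa only [wedge, update_vec₂] using
    (exteriorPower.ιMulti R 3).map_update_add ![x, y, z] 2 z z'

theorem wedge_smul_right (r : R) (x y z : W6 R) : wedge x y (r • z) = r • wedge x y z := by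
  simpa only [wedge, update_vec₂] using
    (exteriorPower.ιMulti R 3).map_update_smul ![x, y, z] 2 r z

theorem wedge_swap (x y z : W6 R) : wedge y x z = -wedge x y z := by
  have h := (exteriorPower.ιMulti R 3).map_swap ![x, y, z] (i := 0) (j := 1) (by decide)
  rw [wedge, wedge, ← h]
  congr 1
  ext i
  fin_cases i <;> rfl

theorem wedge_swap' (x y z : W6 R) : wedge x z y = -wedge x y z := by
  have h := (exteriorPower.ιMulti R 3).map_swap ![x, y, z] (i := 1) (j := 2) (by decide)
  rw [wedge, wedge, ← h]
  congr 1
  ext i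
  fin_cases i <;> rfl

theorem wedge_self_left (x z : W6 R) : wedge x x z = 0 :=
  (exteriorPower.ιMulti R 3).map_eq_zero_of_eq _ (i := 0) (j := 1) rfl (by decide)

theorem wedge_self_right (x y : W6 R) : wedge x y y = 0 :=
  (exteriorPower.ιMulti R 3).map_eq_zero_of_eq _ (i := 1) (j := 2) rfl (by decide)

theorem wedge_self_outer (x y : W6 R) : wedge x y x = 0 :=
  (exteriorPower.ιMulti R 3).map_eq_zero_of_eq _ (i := 0) (j := 2) rfl (by decide)

theorem wedge_add_middle (x y y' z : W6 R) :
    wedge x (y + y') z = wedge x y z + wedge x y' z := by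
  simpa only [wedge, update_vec₁] using
    (exteriorPower.ιMulti R 3).map_update_add ![x, y, z] 1 y y'

theorem wedge_smul_middle (r : R) (x y z : W6 R) : wedge x (r • y) z = r • wedge x y z := by
  simpa only [wedge, update_vec₁] using
    (exteriorPower.ιMulti R 3).map_update_smul ![x, y, z] 1 r y

theorem map_wedge (L : W6 R →ₗ[R] W6 R) (x y z : W6 R) :
    exteriorPower.map 3 L (wedge x y z) = wedge (L x) (L y) (L z) := by
  rw [wedge, exteriorPower.map_apply_ιMulti, wedge]
  congr 1
  ext i
  fin_cases i <;> rfl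

/-- The cross product expansion of a wedge product of two combinations of `f₁, f₂, f₃`. -/
theorem wedge_sum_f_sum_f (x y : Fin 3 → R) (z : W6 R) :
    wedge (∑ k, x k • f R k) (∑ k, y k • f R k) z =
      ∑ k : Fin 3, (x (k + 1) * y (k + 2) - x (k + 2) * y (k + 1)) •
        wedge (f R (k + 1)) (f R (k + 2)) z := by
  simp only [Fin.sum_univ_three, wedge_add_left, wedge_add_middle, wedge_smul_left,
    wedge_smul_middle, wedge_self_left, smul_zero, Fin.isValue, Fin.reduceAdd, zero_add, add_zero]
  rw [wedge_swap (f R 0) (f R 1), wedge_swap (f R 1) (f R 2), wedge_swap (f R 2) (f R 0)]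
  module

theorem wedge_f_f_sum (k : Fin 3) (x y : Fin 3 → R) :
    wedge (f R (k + 1)) (f R (k + 2)) (∑ l, x l • e R l + ∑ l, y l • f R l) =
      ∑ l, x l • wedge (f R (k + 1)) (f R (k + 2)) (e R l) +
        y k • wedge (f R 0) (f R 1) (f R 2) := by
  have h1 : wedge (f R 1) (f R 2) (f R 0) = wedge (f R 0) (f R 1) (f R 2) := by
    rw [wedge_swap', wedge_swap, neg_neg]
  have h2 : wedge (f R 2) (f R 0) (f R 1) = wedge (f R 0) (f R 1) (f R 2) := by
    rw [wedge_swap, wedge_swap', neg_neg]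
  simp only [Fin.sum_univ_three, wedge_add_right, wedge_smul_right]
  fin_cases k <;>
  simp [wedge_self_outer, wedge_self_right, h1, h2]

theorem vecMul_f (P Q m : Matrix (Fin 3) (Fin 3) R) (i : Fin 3) :
    Matrix.vecMulLinear (Matrix.fromBlocks P Q 0 m) (f R i) = ∑ k, m i k • f R k := by
  ext j
  rcases j with j | j <;> simp [f, Finset.sum_apply, Pi.single_apply]

theorem vecMul_e (P Q m : Matrix (Fin 3) (Fin 3) R) (i : Fin 3) :
    Matrix.vecMulLinear (Matrix.fromBlocks P Q 0 m) (e R i) =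
      ∑ k, P i k • e R k + ∑ k, Q i k • f R k := by
  ext j
  rcases j with j | j <;> simp [e, f, Finset.sum_apply, Pi.single_apply]

/-- With cyclic indices the cofactor signs disappear, which matches the convention `f_i^* = f_{i+1}
∧ f_{i+2}`. -/
theorem adjugate_eq_cross (m : Matrix (Fin 3) (Fin 3) R) (k i : Fin 3) :
    m.adjugate k i =
      m (i + 1) (k + 1) * m (i + 2) (k + 2) - m (i + 1) (k + 2) * m (i + 2) (k + 1) := by
  rw [Matrix.adjugate_fin_three]
  fin_cases k <;> fin_cases i <;> simp <;> ring

/-- The linear form on `⋀³ W₆` given by the minor with three prescribed columns. -/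
def minor (c : Fin 3 → Fin 3 ⊕ Fin 3) : ⋀[R]^3 (W6 R) →ₗ[R] R :=
  exteriorPower.alternatingMapLinearEquiv (R := R)
    ((Matrix.detRowAlternating (n := Fin 3) (R := R)).compLinearMap (LinearMap.funLeft R R c))

theorem minor_wedge (c : Fin 3 → Fin 3 ⊕ Fin 3) (x y z : W6 R) :
    minor c (wedge x y z) = x (c 0) * y (c 1) * z (c 2) - x (c 0) * y (c 2) * z (c 1) -
      x (c 1) * y (c 0) * z (c 2) + x (c 1) * y (c 2) * z (c 0) +
      x (c 2) * y (c 0) * z (c 1) - x (c 2) * y (c 1) * z (c 0) := by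
  rw [minor, wedge, exteriorPower.alternatingMapLinearEquiv_apply_ιMulti]
  exact Matrix.det_fin_three _

theorem sum_tmul_rearrange {ι M N : Type*} [Fintype ι] [AddCommGroup M] [AddCommGroup N]
    [Module R M] [Module R N] (a : ι → ι → ι → ι → R) (q : ι → ι → R) (w : ι → ι → M) (w₀ : M)
    (h : ι → ι → N) :
    ∑ i, ∑ j, (∑ k, ∑ l, a i j k l • w k l + q i j • w₀) ⊗ₜ[R] h i j =
      ∑ k, ∑ l, w k l ⊗ₜ[R] (∑ i, ∑ j, a i j k l • h i j) +
        w₀ ⊗ₜ[R] (∑ i, ∑ j, q i j • h i j) := by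
  simp only [TensorProduct.add_tmul, TensorProduct.sum_tmul, TensorProduct.tmul_sum,
    TensorProduct.tmul_smul, ← TensorProduct.smul_tmul', Finset.sum_add_distrib]
  congr 1
  have hcomm (F : ι → ι → ι → ι → M ⊗[R] N) :
      ∑ i, ∑ j, ∑ k, ∑ l, F i j k l = ∑ k, ∑ l, ∑ i, ∑ j, F i j k l := by
    have := Finset.sum_comm (s := Finset.univ) (t := Finset.univ)
      (f := fun (p r : ι × ι) => F p.1 p.2 r.1 r.2)
    simpa only [Fintype.sum_prod_type] using this
  exact hcomm _

theorem wedge_rows (P Q m : Matrix (Fin 3) (Fin 3) R) (i j : Fin 3) :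
    wedge (∑ k, m (i + 1) k • f R k) (∑ k, m (i + 2) k • f R k)
        (∑ k, P j k • e R k + ∑ k, Q j k • f R k) =
      ∑ k : Fin 3, ∑ l : Fin 3, (m.adjugate k i * P j l) •
        wedge (f R (k + 1)) (f R (k + 2)) (e R l) +
      (Q * m.adjugate) j i • wedge (f R 0) (f R 1) (f R 2) := by
  simp only [wedge_sum_f_sum_f, wedge_f_f_sum, adjugate_eq_cross, smul_add, Finset.smul_sum,
    smul_smul, Finset.sum_add_distrib, Matrix.mul_apply, Finset.sum_smul]
  congr 1
  exact Finset.sum_congr rfl fun k _ => by rw [mul_comm]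

theorem nu_UP (u : UP R) : nu (u : GSp6 R) = 1 := by
  have h := mat_mul_J6 (u : GSp6 R)
  rw [mat_UP, J6, Matrix.fromBlocks_transpose, Matrix.fromBlocks_multiply,
    Matrix.fromBlocks_multiply] at h
  have h1 := congrFun (congrFun h (Sum.inl 0)) (Sum.inr 0)
  exact Units.ext (by simpa using h1.symm)

theorem sym_transpose (u : UP R) : (sym u)ᵀ = sym u := by
  obtain ⟨w, hw, h⟩ := u.2
  rw [sym, h, Matrix.toBlocks_fromBlocks₁₂, hw]

end Wedge

/-! ### The orbit of `f_O` under `U_P` and the Levi subgroup. -/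

section Action

variable {α β : ℚ} {R : Type*} [CommRing R] [Algebra ℚ R]

/-- The `f_i` go to the rows of `m`, so the `f_i^*` transform by the adjugate of `m`. The `P`-part
of the image of `e_j` stays in the `c`-component, and its `Q`-part contributes to the coefficient of
`f₁ ∧ f₂ ∧ f₃`. -/
theorem act_toTri (h : H3 α β R) (g : GSp6 R) {P Q m : Matrix (Fin 3) (Fin 3) R}
    (hg : mat g = Matrix.fromBlocks P Q 0 m) :
    act (W.toTri ⟨0, 0, h, 0⟩) g =
      (((nu g)⁻¹ : Rˣ) : R) • (
      ∑ k : Fin 3, ∑ l : Fin 3, wedge (f R (k + 1)) (f R (k + 2)) (e R l) ⊗ₜ[R]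
        (∑ i, ∑ j, (m.adjugate k i * P j l) • h.val i j) +
      wedge (f R 0) (f R 1) (f R 2) ⊗ₜ[R]
        (∑ i, ∑ j, (Q * m.adjugate) j i • h.val i j)) := by
  have h1 : W.toTri ⟨0, 0, h, 0⟩ = ∑ i : Fin 3, ∑ j : Fin 3,
      wedge (f R (i + 1)) (f R (i + 2)) (e R j) ⊗ₜ[R] h.val i j := by
    rw [W.toTri]
    simp only [map_zero, TensorProduct.tmul_zero, zero_add, add_zero,
      ZeroMemClass.coe_zero, Matrix.zero_apply, Finset.sum_const_zero]
  rw [act, hg, h1]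
  refine congrArg _ (Eq.trans ?_ (sum_tmul_rearrange
    (fun i j k l => m.adjugate k i * P j l) (fun i j => (Q * m.adjugate) j i)
    (fun k l => wedge (f R (k + 1)) (f R (k + 2)) (e R l)) _ (fun i j => h.val i j)))
  simp only [map_sum, LinearMap.rTensor_tmul, map_wedge, vecMul_f, vecMul_e, wedge_rows]

/-- The coordinate of an element of `⋀³ W₆ ⊗ B` given by a minor. -/
def triCoord (c : Fin 3 → Fin 3 ⊕ Fin 3) : Tri α β R →ₗ[R] Quat α β R :=
  (TensorProduct.lid R _).toLinearMap ∘ₗ (minor c).rTensor _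

theorem triCoord_tmul (c : Fin 3 → Fin 3 ⊕ Fin 3) (x : ⋀[R]^3 (W6 R)) (q : Quat α β R) :
    triCoord c (x ⊗ₜ[R] q) = minor c x • q := rfl

theorem triCoord_toTri_c (w : W α β R) (i j : Fin 3) :
    triCoord ![.inr (i + 1), .inr (i + 2), .inl j] w.toTri = w.c.val i j := by
  fin_cases i <;> fin_cases j <;>
  simp [W.toTri, triCoord_tmul, minor_wedge, Fin.sum_univ_three, e, f]

theorem triCoord_toTri_d (w : W α β R) :
    triCoord ![.inr 0, .inr 1, .inr 2] w.toTri = algebraMap R (Quat α β R) w.d := by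
  simp [W.toTri, triCoord_tmul, minor_wedge, Fin.sum_univ_three, e, f]

/-- `PhiF` is defined on the image of `W`, so membership in that image must be read back on
components; the minors recover them. -/
theorem c_eq_of_toTri_eq {w w' : W α β R} (h : w.toTri = w'.toTri) : w.c = w'.c := by
  ext i j : 2
  rw [← triCoord_toTri_c, ← triCoord_toTri_c, h]

theorem d_eq_of_toTri_eq {w w' : W α β R} (h : w.toTri = w'.toTri) : w.d = w'.d := by
  have h1 := congrArg (triCoord ![.inr 0, .inr 1, .inr 2]) h
  rw [triCoord_toTri_d, triCoord_toTri_d] at h1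
  simpa [QuaternionAlgebra.algebraMap_eq] using h1

/-- The Hermitian matrix `s n h ᵗn`, for a scalar `s` and a scalar matrix `n`. -/
def hermTwist (s : R) (n : Matrix (Fin 3) (Fin 3) R) (h : H3 α β R) : H3 α β R :=
  ⟨Matrix.of fun k l => ∑ i, ∑ j, (s * n k i * n l j) • h.val i j, by
    rw [selfAdjoint.mem_iff]
    ext k l : 1
    have hh : ∀ i j, star (h.val i j) = h.val j i := fun i j => by
      conv_rhs => rw [← selfAdjoint.mem_iff.1 h.2]
      rfl
    rw [Matrix.star_apply, Matrix.of_apply, Matrix.of_apply, Finset.sum_comm, star_sum]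
    refine Finset.sum_congr rfl fun i _ => ?_
    rw [star_sum]
    refine Finset.sum_congr rfl fun j _ => ?_
    rw [QuaternionAlgebra.star_smul, hh, mul_right_comm]⟩

theorem Quat.tr_eq (x : Quat α β R) : Quat.tr x = 2 * x.re := by
  simp [Quat.tr, two_mul]

theorem GoodBasis.T_eq {O : Subring (Quat α β ℚ)} (G : GoodBasis O) :
    G.T = !![(G.a : ℚ), G.v₃.re, G.v₂.re; G.v₃.re, (G.b : ℚ), G.v₁.re;
      G.v₂.re, G.v₁.re, (G.c : ℚ)] := by
  simp [GoodBasis.T, Quat.tr_eq]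

/-- Since `u` is symmetric, each off-diagonal entry of `A(T)` is paired with its conjugate, and only
traces survive. -/
theorem sum_sym_smul_A {O : Subring (Quat α β ℚ)} (G : GoodBasis O) (u : UP R) :
    ∑ i, ∑ j, sym u j i • (G.A R).val i j = algebraMap R (Quat α β R) (trT G.T u) := by
  have hs : ∀ i j, sym u j i = sym u i j := fun i j => by
    conv_lhs => rw [← sym_transpose u]
    rfl
  rw [GoodBasis.T_eq]
  ext <;>
  simp [trT, GoodBasis.A, hermitian, Matrix.trace_fin_three, Matrix.mul_apply,
    Fin.sum_univ_three, Quat.base, hs 1 0, hs 2 0, hs 2 1, QuaternionAlgebra.algebraMap_eq] <;>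
  ring

theorem act_fO {O : Subring (Quat α β ℚ)} (G : GoodBasis O) (u : UP R) (l : Rˣ)
    (m : GL (Fin 3) R) :
    act (G.fO R).toTri ((u : GSp6 R) * levi l m) =
      W.toTri ⟨0, 0, hermTwist m.val.det (m⁻¹).val (G.A R), ((l⁻¹ : Rˣ) : R) * trT G.T u⟩ := by
  have hg : mat ((u : GSp6 R) * levi l m) = Matrix.fromBlocks
      (((l * Matrix.GeneralLinearGroup.det m : Rˣ) : R) • (m⁻¹).valᵀ) (sym u * m.val) 0 m.val := by
    rw [mat_mul, mat_UP]
    change _ * Matrix.fromBlocks _ _ _ _ = _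
    rw [Matrix.fromBlocks_multiply]
    simp
  have hν : nu ((u : GSp6 R) * levi l m) = l * Matrix.GeneralLinearGroup.det m := by
    change nu (u : GSp6 R) * nu (levi l m) = _
    rw [nu_UP, one_mul]
    rfl
  have hdet : ((Matrix.GeneralLinearGroup.det m : Rˣ) : R) = m.val.det := rfl
  have hadj : m.val.adjugate = m.val.det • (m⁻¹).val := by
    have h1 : m.val.adjugate * (m.val * (m⁻¹).val) = m.val.det • (m⁻¹).val := by
      rw [← Matrix.mul_assoc, Matrix.adjugate_mul, Matrix.smul_mul, Matrix.one_mul]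
    rwa [← Units.val_mul, mul_inv_cancel, Units.val_one, Matrix.mul_one] at h1
  rw [GoodBasis.fO, act_toTri _ _ hg, hν, W.toTri]
  simp only [map_zero, TensorProduct.tmul_zero, zero_add, ZeroMemClass.coe_zero,
    Matrix.zero_apply, Finset.sum_const_zero, smul_add, Finset.smul_sum (N := Tri α β R),
    ← TensorProduct.tmul_smul]
  congr 1
  · refine Finset.sum_congr rfl fun k _ => Finset.sum_congr rfl fun k' _ => ?_
    congr 1
    simp only [hermTwist, Matrix.of_apply, Finset.smul_sum, smul_smul]
    refine Finset.sum_congr rfl fun i _ => Finset.sum_congr rfl fun j _ => ?_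
    congr 1
    rw [hadj, Matrix.smul_apply, Matrix.smul_apply, Matrix.transpose_apply, smul_eq_mul,
      smul_eq_mul]
    -- The similitude `λ det(m)` cancels the same factor in the upper left block.
    linear_combination (m.val.det * (m⁻¹).val k i * (m⁻¹).val k' j) *
      Units.inv_mul (l * Matrix.GeneralLinearGroup.det m)
  · congr 1
    rw [map_mul, ← sum_sym_smul_A, Matrix.mul_assoc, Matrix.mul_adjugate, ← Algebra.smul_def]
    simp only [Finset.smul_sum, smul_smul, Matrix.mul_smul, Matrix.mul_one, Matrix.smul_apply,
      smul_eq_mul]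
    refine Finset.sum_congr rfl fun i _ => Finset.sum_congr rfl fun j _ => ?_
    congr 1
    rw [mul_inv, Units.val_mul, ← hdet]
    linear_combination (((l⁻¹ : Rˣ) : R) * sym u j i) *
      Units.inv_mul (Matrix.GeneralLinearGroup.det m)

end Action

/-! ### Orders with a good basis -/

section Base

variable {α β : ℚ} {R : Type*} [CommRing R] [Algebra ℚ R]

/-- The reduced norm `x x^*`, as an element of the base ring. -/
def Quat.nrm (x : Quat α β R) : R := (x * star x).re

theorem Quat.nrm_eq (x : Quat α β R) : x.nrm = x.re ^ 2 - algebraMap ℚ R α * x.imI ^ 2 -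
    algebraMap ℚ R β * x.imJ ^ 2 + algebraMap ℚ R α * algebraMap ℚ R β * x.imK ^ 2 := by
  simp [Quat.nrm]; ring

theorem Quat.nrm_add (x y : Quat α β R) :
    (x + y).nrm = x.nrm + y.nrm + 2 * (x * star y).re := by
  simp [Quat.nrm]; ring

theorem Quat.nrm_smul (r : R) (x : Quat α β R) : (r • x).nrm = r ^ 2 * x.nrm := by
  simp [Quat.nrm]; ring

theorem Quat.base_mul (x y : Quat α β ℚ) : Quat.base R (x * y) = Quat.base R x * Quat.base R y := by
  ext <;> simp [Quat.base]

theorem Quat.base_star (x : Quat α β ℚ) : Quat.base R (star x) = star (Quat.base R x) := by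
  ext <;> simp [Quat.base]

theorem Quat.base_add (x y : Quat α β ℚ) : Quat.base R (x + y) = Quat.base R x + Quat.base R y := by
  ext <;> simp [Quat.base]

theorem Quat.base_smul (r : ℚ) (x : Quat α β ℚ) :
    Quat.base R (r • x) = algebraMap ℚ R r • Quat.base R x := by
  ext <;> simp [Quat.base] <;> rw [Algebra.smul_def]

theorem Quat.nrm_base (x : Quat α β ℚ) : (Quat.base R x).nrm = algebraMap ℚ R x.nrm := by
  simp [Quat.nrm, Quat.base]

theorem Quat.re_base (x : Quat α β ℚ) : (Quat.base R x).re = algebraMap ℚ R x.re := rfl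

/-- The base change of a rational linear form on `B`. -/
def Quat.baseForm (R : Type*) [CommRing R] [Algebra ℚ R] (φ : Quat α β ℚ →ₗ[ℚ] ℚ) :
    Quat α β R →ₗ[R] R where
  toFun x := algebraMap ℚ R (φ ⟨1, 0, 0, 0⟩) * x.re + algebraMap ℚ R (φ ⟨0, 1, 0, 0⟩) * x.imI +
    algebraMap ℚ R (φ ⟨0, 0, 1, 0⟩) * x.imJ + algebraMap ℚ R (φ ⟨0, 0, 0, 1⟩) * x.imK
  map_add' x y := by simp; ring
  map_smul' r x := by simp; ring

theorem Quat.baseForm_base (φ : Quat α β ℚ →ₗ[ℚ] ℚ) (x : Quat α β ℚ) :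
    Quat.baseForm R φ (Quat.base R x) = algebraMap ℚ R (φ x) := by
  have h : x = x.re • ⟨1, 0, 0, 0⟩ + x.imI • ⟨0, 1, 0, 0⟩ + x.imJ • ⟨0, 0, 1, 0⟩ +
      x.imK • ⟨0, 0, 0, 1⟩ := by ext <;> simp
  conv_rhs => rw [h]
  simp only [Quat.baseForm, Quat.base, LinearMap.coe_mk, AddHom.coe_mk, map_add, map_smul,
    smul_eq_mul, map_mul]
  ring

end Base

namespace GoodBasis

variable {α β : ℚ} {O : Subring (Quat α β ℚ)} (G : GoodBasis O)

/-- The vectors `1, v₁, v₂, v₃` of a good basis. -/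
def vec : Fin 4 → Quat α β ℚ := ![1, G.v₁, G.v₂, G.v₃]

/-- A good basis, as a basis of `B` over `ℚ`. -/
def basis : Module.Basis (Fin 4) ℚ (Quat α β ℚ) :=
  basisOfLinearIndependentOfCardEqFinrank (b := G.vec)
    ((LinearIndependent.iff_fractionRing ℤ ℚ).1 G.linearIndependent)
    (by rw [QuaternionAlgebra.finrank_eq_four]; rfl)

theorem coe_basis : ⇑G.basis = G.vec := coe_basisOfLinearIndependentOfCardEqFinrank _ _

theorem mem_iff_mem_span {x : Quat α β ℚ} : x ∈ O ↔ x ∈ Submodule.span ℤ (Set.range G.vec) := by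
  rw [vec, G.span_eq]; rfl

theorem vec_mem (k : Fin 4) : G.vec k ∈ O :=
  G.mem_iff_mem_span.2 (Submodule.subset_span ⟨k, rfl⟩)

theorem repr_int {x : Quat α β ℚ} (hx : x ∈ O) (k : Fin 4) : ∃ n : ℤ, G.basis.repr x k = n := by
  rw [G.mem_iff_mem_span, ← coe_basis, Module.Basis.mem_span_iff_repr_mem] at hx
  obtain ⟨n, hn⟩ := hx k
  exact ⟨n, by simpa using hn.symm⟩

/-- The coordinates of an element of `B ⊗ R` in a good basis. -/
def coord (R : Type*) [CommRing R] [Algebra ℚ R] (k : Fin 4) : Quat α β R →ₗ[R] R :=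
  Quat.baseForm R (G.basis.coord k)

theorem coord_vec (R : Type*) [CommRing R] [Algebra ℚ R] (k j : Fin 4) :
    G.coord R k (Quat.base R (G.vec j)) = if j = k then 1 else 0 := by
  rw [coord, Quat.baseForm_base, ← coe_basis, Module.Basis.coord_apply, Module.Basis.repr_self,
    Finsupp.single_apply]
  split_ifs <;> simp

theorem coord_mem_Zhat {y : Quat α β Af} (hy : y ∈ orderHat O) (k : Fin 4) :
    G.coord Af k y ∈ Zhat := by
  induction hy using Submodule.span_induction with
  | mem y hy =>
    obtain ⟨x, hx, rfl⟩ := hy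
    rw [coord, Quat.baseForm_base]
    obtain ⟨n, hn⟩ := G.repr_int hx k
    rw [Module.Basis.coord_apply, hn]
    exact intCast_mem_Zhat n
  | zero => simp
  | add x y _ _ hx hy => rw [map_add]; exact add_mem hx hy
  | smul r x _ hx =>
    rw [show r • x = (r : Af) • x from rfl, map_smul]
    exact mul_mem r.2 hx

theorem smul_base_mem {r : Af} (hr : r ∈ Zhat) {x : Quat α β ℚ} (hx : x ∈ O) :
    r • Quat.base Af x ∈ orderHat O :=
  Submodule.smul_mem _ (⟨r, hr⟩ : Zhat) (Submodule.subset_span ⟨x, hx, rfl⟩)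

theorem orderHat_le_span :
    orderHat O ≤ Submodule.span Zhat (Set.range fun k => Quat.base Af (G.vec k)) := by
  refine Submodule.span_le.2 ?_
  rintro _ ⟨x, hx, rfl⟩
  rw [SetLike.mem_coe, G.mem_iff_mem_span] at hx
  induction hx using Submodule.span_induction with
  | mem x hx =>
    obtain ⟨k, rfl⟩ := hx
    exact Submodule.subset_span ⟨k, rfl⟩
  | zero =>
    rw [show Quat.base Af (0 : Quat α β ℚ) = 0 by ext <;> simp [Quat.base]]
    exact zero_mem _
  | add x y _ _ hx hy => rw [Quat.base_add]; exact add_mem hx hy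
  | smul n x _ hx =>
    have h : Quat.base Af (n • x) = (⟨algebraMap ℚ Af n, intCast_mem_Zhat n⟩ : Zhat) •
        Quat.base Af x := by
      rw [← Int.cast_smul_eq_zsmul ℚ, Quat.base_smul]; rfl
    rw [h]
    exact Submodule.smul_mem _ _ hx

/-- The quadratic equation of a basis vector. -/
theorem vec_mul_self (k : Fin 4) :
    G.vec k * G.vec k = (2 * (G.vec k).re) • G.vec k - (G.vec k).nrm • G.vec 0 := by
  ext <;> simp [vec, Quat.nrm] <;> ring

theorem trace_nrm_vec (k : Fin 4) :
    (∃ n : ℤ, 2 * (G.vec k).re = n) ∧ ∃ n : ℤ, (G.vec k).nrm = n := by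
  by_cases hk : k = 0
  · subst hk
    exact ⟨⟨2, by simp [vec]⟩, ⟨1, by simp [vec, Quat.nrm]⟩⟩
  -- By `vec_mul_self`, the coordinates of `v² ∈ O` along `v` and `1` are `tr v` and `-n(v)`. The
  -- case `v = 1` was set apart because the two coordinates then coincide.
  have h := mul_mem (G.vec_mem k) (G.vec_mem k)
  rw [vec_mul_self, ← coe_basis] at h
  obtain ⟨n, hn⟩ := G.repr_int h k
  obtain ⟨n', hn'⟩ := G.repr_int h 0
  rw [map_sub, map_smul, map_smul, Module.Basis.repr_self, Module.Basis.repr_self] at hn hn'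
  rw [← coe_basis]
  refine ⟨⟨n, ?_⟩, ⟨-n', ?_⟩⟩
  · simpa [Finsupp.single_apply, hk, Ne.symm hk] using hn
  · rw [Int.cast_neg, ← hn']
    simp [hk]

theorem trace_mem_Zhat (G : GoodBasis O) {y : Quat α β Af} (hy : y ∈ orderHat O) : 2 * y.re ∈ Zhat := by
  replace hy := G.orderHat_le_span hy
  induction hy using Submodule.span_induction with
  | mem y hy =>
    obtain ⟨k, rfl⟩ := hy
    obtain ⟨n, hn⟩ := (G.trace_nrm_vec k).1
    have h : 2 * (Quat.base Af (G.vec k)).re = algebraMap ℚ Af (2 * (G.vec k).re) := by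
      rw [map_mul, map_ofNat, Quat.re_base]
    rw [h, hn]
    exact intCast_mem_Zhat n
  | zero => simp
  | add x y _ _ hx hy => rw [QuaternionAlgebra.re_add, mul_add]; exact add_mem hx hy
  | smul r x _ hx =>
    have h : 2 * (r • x).re = r * (2 * x.re) := by
      rw [show r • x = (r : Af) • x from rfl, QuaternionAlgebra.re_smul, smul_eq_mul]; ring
    rw [h]
    exact mul_mem r.2 hx

theorem star_mem (G : GoodBasis O) {x : Quat α β ℚ} (hx : x ∈ O) : star x ∈ O := by
  have h := G.trace_mem_Zhat (Submodule.subset_span ⟨x, hx, rfl⟩ : Quat.base Af x ∈ orderHat O)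
  have h2 : 2 * (Quat.base Af x).re = algebraMap ℚ Af (2 * x.re) := by
    rw [map_mul, map_ofNat, Quat.re_base]
  rw [h2, algebraMap_mem_Zhat_iff] at h
  obtain ⟨n, hn⟩ := h
  have h3 : star x = (n : Quat α β ℚ) - x := by
    ext <;> simp [← hn]
    ring
  rw [h3]
  exact sub_mem (intCast_mem O n) hx

theorem polar_mem_Zhat (G : GoodBasis O) {x y : Quat α β Af} (hx : x ∈ orderHat O) (hy : y ∈ orderHat O) :
    2 * (x * star y).re ∈ Zhat := by
  induction hx, hy using Submodule.span_induction₂ with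
  | mem_mem x y hx hy =>
    obtain ⟨x, hx, rfl⟩ := hx
    obtain ⟨y, hy, rfl⟩ := hy
    rw [← Quat.base_star, ← Quat.base_mul]
    exact G.trace_mem_Zhat (Submodule.subset_span ⟨_, mul_mem hx (G.star_mem hy), rfl⟩)
  | zero_left => simp
  | zero_right => simp
  | add_left x y z _ _ _ hx hy =>
    rw [add_mul, QuaternionAlgebra.re_add, mul_add]; exact add_mem hx hy
  | add_right x y z _ _ _ hx hy =>
    rw [star_add, mul_add, QuaternionAlgebra.re_add, mul_add]; exact add_mem hx hy
  | smul_left r x y _ _ h =>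
    have h1 : 2 * (r • x * star y).re = r * (2 * (x * star y).re) := by
      rw [show r • x = (r : Af) • x from rfl, smul_mul_assoc, QuaternionAlgebra.re_smul,
        smul_eq_mul]; ring
    rw [h1]
    exact mul_mem r.2 h
  | smul_right r x y _ _ h =>
    have h1 : 2 * (x * star (r • y)).re = r * (2 * (x * star y).re) := by
      rw [show r • y = (r : Af) • y from rfl, QuaternionAlgebra.star_smul, mul_smul_comm,
        QuaternionAlgebra.re_smul, smul_eq_mul]; ring
    rw [h1]
    exact mul_mem r.2 h

theorem nrm_mem_Zhat (G : GoodBasis O) {y : Quat α β Af} (hy : y ∈ orderHat O) : y.nrm ∈ Zhat := by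
  have hle : Submodule.span Zhat (Set.range fun k => Quat.base Af (G.vec k)) ≤ orderHat O := by
    refine Submodule.span_mono ?_
    rintro _ ⟨k, rfl⟩
    exact ⟨_, G.vec_mem k, rfl⟩
  replace hy := G.orderHat_le_span hy
  induction hy using Submodule.span_induction with
  | mem y hy =>
    obtain ⟨k, rfl⟩ := hy
    obtain ⟨n, hn⟩ := (G.trace_nrm_vec k).2
    simp only [Quat.nrm_base, hn]
    exact intCast_mem_Zhat n
  | zero => simp [Quat.nrm]
  | add x y hx hy hx' hy' =>
    rw [Quat.nrm_add]
    exact add_mem (add_mem hx' hy') (G.polar_mem_Zhat (hle hx) (hle hy))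
  | smul r x _ hx =>
    rw [show r • x = (r : Af) • x from rfl, Quat.nrm_smul]
    exact mul_mem (pow_mem r.2 2) hx

/-- These are the real parts of the entries of `A(T)^# = 0`. The later uses evaluate `A(T)^#` as a
quadratic form on scalar vectors, or pair the `v_i` under the norm form, and see nothing else. -/
theorem sharp_re_eqs (R : Type*) [CommRing R] [Algebra ℚ R] :
    let x := Quat.base R G.v₁
    let y := Quat.base R G.v₂
    let z := Quat.base R G.v₃
    let a := algebraMap ℚ R G.a
    let b := algebraMap ℚ R G.b
    let c := algebraMap ℚ R G.c
    b * c = x.nrm ∧ a * c = y.nrm ∧ a * b = z.nrm ∧ (star y * star x).re = c * z.re ∧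
      (z * x).re = b * y.re ∧ (star z * star y).re = a * x.re := by
  have h := G.rankOne.1
  have e : ∀ i j, (sharp (hermitian (R := ℚ) G.a G.b G.c G.v₁ G.v₂ G.v₃).val i j).re = 0 := by
    intro i j; rw [h]; rfl
  have e00 := e 0 0
  have e11 := e 1 1
  have e22 := e 2 2
  have e01 := e 0 1
  have e02 := e 0 2
  have e12 := e 1 2
  simp only [sharp, hermitian, Matrix.of_apply, Matrix.cons_val', Matrix.cons_val_zero,
    Matrix.cons_val_one, Matrix.cons_val, Matrix.cons_val_fin_one, QuaternionAlgebra.re_sub,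
    sub_eq_zero] at e00 e11 e22 e01 e02 e12
  have mapEq : ∀ {p q : ℚ}, p = q → algebraMap ℚ R p = algebraMap ℚ R q := fun h => by rw [h]
  refine ⟨?_, ?_, ?_, ?_, ?_, ?_⟩
  · have := mapEq e00
    simpa [Quat.nrm, Quat.base, QuaternionAlgebra.algebraMap_eq] using this
  · have := mapEq e11
    simpa [Quat.nrm, Quat.base, QuaternionAlgebra.algebraMap_eq] using this
  · have := mapEq e22
    simpa [Quat.nrm, Quat.base, QuaternionAlgebra.algebraMap_eq] using this
  · have := mapEq e01
    simpa [Quat.nrm, Quat.base, QuaternionAlgebra.algebraMap_eq] using this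
  · have := mapEq e02
    simpa [Quat.nrm, Quat.base, QuaternionAlgebra.algebraMap_eq] using this
  · have := mapEq e12
    simpa [Quat.nrm, Quat.base, QuaternionAlgebra.algebraMap_eq] using this

end GoodBasis

/-! ### Integrality of the twisted Hermitian matrix -/

/-- If `|s|_v > 1 ≥ |t|_v`, then `|s + t|_v = |s|_v`, so `|s(s + t)|_v > 1`. -/
theorem mem_Zhat_of_quadratic {s t : Af} (ht : t ∈ Zhat) (h : s ^ 2 + s * t ∈ Zhat) : s ∈ Zhat := by
  intro v
  by_contra hs
  rw [IsDedekindDomain.HeightOneSpectrum.mem_adicCompletionIntegers, not_le] at hs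
  have h1 := mem_Zhat_iff.1 h v
  have h2 : Valued.v (s v + t v) = Valued.v (s v) :=
    Valuation.map_add_eq_of_lt_left _ ((mem_Zhat_iff.1 ht v).trans_lt hs)
  rw [sq, ← mul_add, Af.mul_apply, Af.add_apply, map_mul, h2] at h1
  exact absurd h1 (not_le.2 (one_lt_mul'' hs hs))

theorem Quat.eq_algebraMap_of_star_eq {α β : ℚ} (x : Quat α β Af) (h : star x = x) :
    x = algebraMap Af _ x.re := by
  have key : ∀ y : Af, -y = y → y = 0 := fun y hy => by
    have h1 : (2 : Af) * y = 0 := by linear_combination -hy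
    have h2 : IsUnit (2 : Af) := by
      rw [← map_ofNat (algebraMap ℚ Af)]
      exact (IsUnit.mk0 (2 : ℚ) two_ne_zero).map _
    exact (h2.mul_right_eq_zero).1 h1
  have h1 := congrArg QuaternionAlgebra.imI h
  have h2 := congrArg QuaternionAlgebra.imJ h
  have h3 := congrArg QuaternionAlgebra.imK h
  simp only [QuaternionAlgebra.imI_star, QuaternionAlgebra.imJ_star,
    QuaternionAlgebra.imK_star] at h1 h2 h3
  ext <;> simp [QuaternionAlgebra.algebraMap_eq, key _ h1, key _ h2, key _ h3]

theorem H3.star_apply {α β : ℚ} {R : Type*} [CommRing R] [Algebra ℚ R] (h : H3 α β R)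
    (i j : Fin 3) : star (h.val i j) = h.val j i := by
  conv_rhs => rw [← selfAdjoint.mem_iff.1 h.2]
  rfl

theorem mem_J0Hat_iff {α β : ℚ} {O : Subring (Quat α β ℚ)} (h : H3 α β Af) :
    h ∈ J0Hat O ↔ (∀ i, (h.val i i).re ∈ Zhat) ∧
      ∀ i : Fin 3, h.val (i + 1) (i + 2) ∈ orderHat O := by
  constructor
  · rintro ⟨c₁, h₁, c₂, h₂, c₃, h₃, x₁, y₁, x₂, y₂, x₃, y₃, rfl⟩
    constructor <;> intro i <;> fin_cases i <;>
    simpa [hermitian, QuaternionAlgebra.algebraMap_eq]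
  · rintro ⟨hd, ho⟩
    refine ⟨_, hd 0, _, hd 1, _, hd 2, _, ho 0, _, ho 1, _, ho 2, ?_⟩
    have hdiag := fun i => Quat.eq_algebraMap_of_star_eq _ (H3.star_apply h i i)
    ext i j : 2
    have hs := H3.star_apply h
    fin_cases i <;> fin_cases j <;>
    simp [hermitian, ← hdiag, hs]

/-! ### The twisted matrix `C = det(m) m⁻¹ A(T) ᵗm⁻¹`, and the nonvanishing of `T`. -/

section Twist

variable {α β : ℚ} {O : Subring (Quat α β ℚ)} (G : GoodBasis O)

theorem re_hermTwist_A (m : GL (Fin 3) Af) (k l : Fin 3) :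
    ((hermTwist m.val.det (m⁻¹).val (G.A Af)).val k l).re = twist G.T m k l := by
  have hA : ∀ i j, ((G.A Af).val i j).re = algebraMap ℚ Af (G.T i j) := by
    intro i j
    rw [GoodBasis.T_eq]
    fin_cases i <;> fin_cases j <;>
    simp [GoodBasis.A, hermitian, Quat.base]
  simp only [hermTwist, twist, Matrix.of_apply, Fin.sum_univ_three, QuaternionAlgebra.re_add,
    QuaternionAlgebra.re_smul, smul_eq_mul, hA, Matrix.mul_apply, Matrix.smul_apply,
    Matrix.transpose_apply, Matrix.map_apply]
  ring

/-- The adjugate of `m⁻¹` is `det(m)⁻¹ m`. -/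
theorem twist_cross (m : GL (Fin 3) Af) (k i : Fin 3) :
    m.val.det * ((m⁻¹).val (i + 1) (k + 1) * (m⁻¹).val (i + 2) (k + 2) -
      (m⁻¹).val (i + 1) (k + 2) * (m⁻¹).val (i + 2) (k + 1)) = m.val k i := by
  rw [← adjugate_eq_cross]
  have h1 : m.val * ((m⁻¹).val * (m⁻¹).val.adjugate) = (m⁻¹).val.det • m.val := by
    rw [Matrix.mul_adjugate, Matrix.mul_smul, Matrix.mul_one]
  rw [← Matrix.mul_assoc, ← Units.val_mul, mul_inv_cancel, Units.val_one, Matrix.one_mul] at h1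
  have h2 : m.val.det * (m⁻¹).val.det = 1 := by
    rw [← Matrix.det_mul, ← Units.val_mul, mul_inv_cancel, Units.val_one, Matrix.det_one]
  rw [h1, Matrix.smul_apply, smul_eq_mul, ← mul_assoc, h2, one_mul]

/-- The off-diagonal entries of the twisted matrix, up to scalars. -/
theorem hermTwist_offDiag (m : GL (Fin 3) Af) (i : Fin 3) : ∃ s : Af,
    (hermTwist m.val.det (m⁻¹).val (G.A Af)).val (i + 1) (i + 2) =
      s • Quat.base Af (G.vec 0) + ∑ k : Fin 3, m.val k i • Quat.base Af (G.vec k.succ) := by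
  have h0 : Quat.base Af (G.vec 0) = 1 := by ext <;> simp [Quat.base, GoodBasis.vec]
  have h1 : ∀ x y : Quat α β Af, x.imI = y.imI → x.imJ = y.imJ → x.imK = y.imK →
      x = (x.re - y.re) • (1 : Quat α β Af) + y := fun x y hI hJ hK => by
    ext <;> simp [hI, hJ, hK]
  refine ⟨_, (h1 _ _ ?_ ?_ ?_).trans (by rw [h0])⟩ <;>
  · simp only [← twist_cross m, hermTwist, Fin.sum_univ_three]
    simp [GoodBasis.A, hermitian, GoodBasis.vec]
    ring

theorem nrm_hermTwist {R : Type*} [CommRing R] [Algebra ℚ R] (s : R)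
    (n : Matrix (Fin 3) (Fin 3) R) (k l : Fin 3) :
    ((hermTwist s n (G.A R)).val k l).nrm =
      ((hermTwist s n (G.A R)).val k k).re * ((hermTwist s n (G.A R)).val l l).re := by
  obtain ⟨e1, e2, e3, e4, e5, e6⟩ := G.sharp_re_eqs R
  simp only [Quat.nrm_eq, QuaternionAlgebra.re_mul, QuaternionAlgebra.re_star,
    QuaternionAlgebra.imI_star, QuaternionAlgebra.imJ_star, QuaternionAlgebra.imK_star]
    at e1 e2 e3 e4 e5 e6
  simp only [Quat.nrm_eq, hermTwist, Fin.sum_univ_three, GoodBasis.A, hermitian]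
  simp
  simp only [map_intCast] at e1 e2 e3 e4 e5 e6
  generalize n k 0 = p₀, n k 1 = p₁, n k 2 = p₂, n l 0 = q₀, n l 1 = q₁, n l 2 = q₂
  generalize Quat.base R G.v₁ = x, Quat.base R G.v₂ = y, Quat.base R G.v₃ = z at *
  -- For the rows `p`, `q` of `n`, the difference `C_kk C_ll - n(C_kl)` is `s²` times the value of
  -- the form `A(T)^#` at the cross product `p × q`.
  linear_combination (-s ^ 2) * ((p₁ * q₂ - p₂ * q₁) ^ 2 * e1 + (p₂ * q₀ - p₀ * q₂) ^ 2 * e2 +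
    (p₀ * q₁ - p₁ * q₀) ^ 2 * e3 + 2 * (p₁ * q₂ - p₂ * q₁) * (p₂ * q₀ - p₀ * q₂) * e4 +
    2 * (p₁ * q₂ - p₂ * q₁) * (p₀ * q₁ - p₁ * q₀) * e5 +
    2 * (p₂ * q₀ - p₀ * q₂) * (p₀ * q₁ - p₁ * q₀) * e6)

theorem hermTwist_mem_J0Hat_iff (m : GL (Fin 3) Af) :
    hermTwist m.val.det (m⁻¹).val (G.A Af) ∈ J0Hat O ↔
      (∀ i j, m.val i j ∈ Zhat) ∧ IsHalfIntegral (twist G.T m) := by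
  set C := hermTwist m.val.det (m⁻¹).val (G.A Af) with hC
  have hre : ∀ k l, (C.val k l).re = twist G.T m k l := re_hermTwist_A G m
  have hsym : ∀ k l, twist G.T m k l = twist G.T m l k := fun k l => by
    rw [← hre, ← hre, ← H3.star_apply C]
    simp
  have h0 : Quat.base Af (G.vec 0) = 1 := by ext <;> simp [Quat.base, GoodBasis.vec]
  rw [mem_J0Hat_iff]
  constructor
  · rintro ⟨hd, ho⟩
    refine ⟨fun i j => ?_, ?_, fun i => hre i i ▸ hd i, ?_⟩
    · obtain ⟨s, hs⟩ := hermTwist_offDiag G m j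
      -- The unknown scalar `s` only affects the coordinate along `1`; the coordinate along the
      -- basis vector `i.succ` is `m i j`.
      have h := G.coord_mem_Zhat (ho j) i.succ
      rw [hs, map_add, map_smul, map_sum] at h
      simpa [G.coord_vec, (Fin.succ_ne_zero i).symm] using h
    · exact Matrix.ext fun i j => hsym j i
    · have h : ∀ i : Fin 3, 2 * twist G.T m (i + 1) (i + 2) ∈ Zhat := fun i => by
        rw [← hre]; exact G.trace_mem_Zhat (ho i)
      intro i j hij
      fin_cases i <;> fin_cases j <;> first | exact absurd rfl hij | skip
      · exact h 2
      · rw [hsym]; exact h 1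
      · rw [hsym]; exact h 2
      · exact h 0
      · exact h 1
      · rw [hsym]; exact h 0
  · rintro ⟨hm, -, hd, -⟩
    refine ⟨fun i => hre i i ▸ hd i, fun i => ?_⟩
    obtain ⟨s, hs⟩ := hermTwist_offDiag G m i
    set y := ∑ k : Fin 3, m.val k i • Quat.base Af (G.vec k.succ) with hy
    have hyO : y ∈ orderHat O := sum_mem fun k _ => GoodBasis.smul_base_mem (hm k i) (G.vec_mem _)
    have hn := nrm_hermTwist G m.val.det (m⁻¹).val (i + 1) (i + 2)
    rw [← hC, hre, hre, hC, hs, Quat.nrm_add, Quat.nrm_smul, h0] at hn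
    have h1 : s ^ 2 + s * (2 * y.re) = twist G.T m (i + 1) (i + 1) * twist G.T m (i + 2) (i + 2) -
        y.nrm := by
      rw [← hn]
      simp [Quat.nrm]
      ring
    have hsZ : s ∈ Zhat := mem_Zhat_of_quadratic (G.trace_mem_Zhat hyO) (by
      rw [h1]; exact sub_mem (mul_mem (hd _) (hd _)) (G.nrm_mem_Zhat hyO))
    rw [hC, hs]
    exact add_mem (GoodBasis.smul_base_mem hsZ (G.vec_mem 0)) hyO

/-- If `T = 0`, the `v_i` are traceless and the rank one equations make them isotropic and mutually
orthogonal for the norm form. They span the traceless quaternions, so `i` is orthogonal to each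
`v_j`, whose `i`-component must vanish; but then they cannot span `i`. -/
theorem GoodBasis.T_ne_zero (hα : α ≠ 0) : G.T ≠ 0 := by
  intro hT
  rw [GoodBasis.T_eq] at hT
  have hT' := fun i j => congrFun (congrFun hT i) j
  have ha := hT' 0 0
  have hb := hT' 1 1
  have hc := hT' 2 2
  have hx := hT' 1 2
  have hy := hT' 0 2
  have hz := hT' 0 1
  simp at ha hb hc hx hy hz
  obtain ⟨e1, e2, e3, e4, e5, e6⟩ := G.sharp_re_eqs ℚ
  simp [Quat.nrm, Quat.base, ha, hb, hc, hx, hy, hz] at e1 e2 e3 e4 e5 e6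
  have hi := G.basis.sum_repr (⟨0, 1, 0, 0⟩ : Quat α β ℚ)
  rw [GoodBasis.coe_basis, Fin.sum_univ_four] at hi
  generalize G.basis.repr (⟨0, 1, 0, 0⟩ : Quat α β ℚ) = c at hi
  have i1 := congrArg QuaternionAlgebra.imI hi
  have i2 := congrArg QuaternionAlgebra.imJ hi
  have i3 := congrArg QuaternionAlgebra.imK hi
  simp [GoodBasis.vec] at i1 i2 i3
  have k1 : G.v₁.imI = 0 := by
    apply mul_left_cancel₀ hα
    linear_combination (-α * G.v₁.imI) * i1 - β * G.v₁.imJ * i2 + α * β * G.v₁.imK * i3 +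
      c 1 * e1 + c 2 * e4 + c 3 * e5
  have k2 : G.v₂.imI = 0 := by
    apply mul_left_cancel₀ hα
    linear_combination (-α * G.v₂.imI) * i1 - β * G.v₂.imJ * i2 + α * β * G.v₂.imK * i3 +
      c 1 * e4 + c 2 * e2 + c 3 * e6
  have k3 : G.v₃.imI = 0 := by
    apply mul_left_cancel₀ hα
    linear_combination (-α * G.v₃.imI) * i1 - β * G.v₃.imJ * i2 + α * β * G.v₃.imK * i3 +
      c 1 * e5 + c 2 * e6 + c 3 * e3
  simp [k1, k2, k3] at i1

end Twist

/-! ### The quotient of the unipotent radical -/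

/-- The element of `U_P` with a given symmetric matrix. -/
def unip {R : Type*} [CommRing R] (u : Matrix (Fin 3) (Fin 3) R) (hu : uᵀ = u) : UP R :=
  ⟨⟨(⟨Matrix.fromBlocks 1 u 0 1, Matrix.fromBlocks 1 (-u) 0 1,
      by simp [Matrix.fromBlocks_multiply], by simp [Matrix.fromBlocks_multiply]⟩, 1), by
    change Matrix.fromBlocks _ _ _ _ * J6 R * (Matrix.fromBlocks _ _ _ _)ᵀ = _ • J6 R
    simp [J6, Matrix.fromBlocks_transpose, Matrix.fromBlocks_multiply, hu]⟩, u, hu, rfl⟩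

theorem sym_unip {R : Type*} [CommRing R] (u : Matrix (Fin 3) (Fin 3) R) (hu : uᵀ = u) :
    sym (unip u hu) = u := Matrix.toBlocks_fromBlocks₁₂ ..

theorem trT_surjective {R : Type*} [CommRing R] [Algebra ℚ R] {T : Matrix (Fin 3) (Fin 3) ℚ}
    (hsymm : Tᵀ = T) (hT : T ≠ 0) : Function.Surjective (trT (R := R) T) := by
  intro t
  have h0 : (T * T).trace ≠ 0 := by
    intro h
    refine hT (Matrix.trace_conjTranspose_mul_self_eq_zero_iff.1 ?_)
    rwa [Matrix.conjTranspose_eq_transpose_of_trivial, hsymm]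
  -- A multiple of `T` itself is a preimage, as `tr(T²)` is the sum of the squares of the rational
  -- entries of `T`.
  refine ⟨unip ((t * algebraMap ℚ R (T * T).trace⁻¹) • T.map (algebraMap ℚ R)) ?_, ?_⟩
  · rw [Matrix.transpose_smul, ← Matrix.transpose_map, hsymm]
  · have h1 : (T.map (algebraMap ℚ R) * T.map (algebraMap ℚ R)).trace =
        algebraMap ℚ R (T * T).trace := by
      rw [← Matrix.map_mul]
      exact (AddMonoidHom.map_trace (algebraMap ℚ R).toAddMonoidHom _).symm
    rw [trT, sym_unip, Matrix.mul_smul, Matrix.trace_smul, smul_eq_mul, h1, mul_assoc, ← map_mul,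
      inv_mul_cancel₀ h0, map_one, mul_one]

theorem continuous_trT (T : Matrix (Fin 3) (Fin 3) ℚ) : Continuous (trT (R := Af) T) := by
  have h : Continuous fun u : UP Af => sym u := by
    have h1 : Continuous fun u : UP Af => mat (u : GSp6 Af) :=
      Units.continuous_val.comp
        (continuous_fst.comp (continuous_subtype_val.comp continuous_subtype_val))
    exact continuous_matrix fun i j => h1.matrix_elem _ _
  exact (continuous_const.matrix_mul h).matrix_trace

/-- The map induced by `u ↦ tr(Tu)` on `U_0(R) \ U_P(R)`. -/
def trTQuot (R : Type*) [CommRing R] [Algebra ℚ R] (T : Matrix (Fin 3) (Fin 3) ℚ) :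
    UP R ⧸ U0 R T → R := fun x =>
  (QuotientGroup.lift (U0 R T) (⟨⟨fun u => Multiplicative.ofAdd (trT T u), by simp [trT_one]⟩,
    fun u w => by simp [trT_mul]⟩ : UP R →* Multiplicative R) fun _ hu => hu) x |>.toAdd

section

variable {R : Type*} [CommRing R] [Algebra ℚ R] (T : Matrix (Fin 3) (Fin 3) ℚ)

theorem trTQuot_mul (x y : UP R ⧸ U0 R T) :
    trTQuot R T (x * y) = trTQuot R T x + trTQuot R T y := by
  simp [trTQuot]

end

theorem continuous_trTQuot (T : Matrix (Fin 3) (Fin 3) ℚ) : Continuous (trTQuot Af T) :=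
  (QuotientGroup.isQuotientMap_mk (N := U0 Af T)).continuous_iff.2 (continuous_trT T)

/-- Integrality depends only on valuations, so the idele may be replaced by its rational generator.
-/
theorem inv_mul_mem_Zhat_iff {l : Afˣ} {q : ℚ}
    (h : ∀ v, Valued.v ((l : Af) v) = v.valuation ℚ q) (x : Af) :
    ((l⁻¹ : Afˣ) : Af) * x ∈ Zhat ↔ algebraMap ℚ Af q⁻¹ * x ∈ Zhat := by
  rw [mem_Zhat_iff, mem_Zhat_iff]
  refine forall_congr' fun v => ?_
  have h1 : Valued.v ((l : Af) v) * Valued.v (((l⁻¹ : Afˣ) : Af) v) = 1 := by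
    rw [← map_mul, ← Af.mul_apply, ← Units.val_mul, mul_inv_cancel, Units.val_one, Af.one_apply,
      map_one]
  rw [Af.mul_apply, Af.mul_apply, map_mul, map_mul, valued_algebraMap, map_inv₀, ← h,
    eq_inv_of_mul_eq_one_right h1]

theorem zero_mem_J0Hat {α β : ℚ} (O : Subring (Quat α β ℚ)) : (0 : H3 α β Af) ∈ J0Hat O := by
  rw [mem_J0Hat_iff]
  simp only [ZeroMemClass.coe_zero, Matrix.zero_apply, QuaternionAlgebra.re_zero]
  exact ⟨fun _ => zero_mem _, fun _ => zero_mem _⟩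

theorem fO_act_mem_iff {α β : ℚ} {O : Subring (Quat α β ℚ)} (G : GoodBasis O) (u : UP Af)
    (l : Afˣ) (m : GL (Fin 3) Af) :
    act (G.fO Af).toTri ((u : GSp6 Af) * levi l m) ∈ W.toTri '' WHat O ↔
      ((l⁻¹ : Afˣ) : Af) * trT G.T u ∈ Zhat ∧
        (∀ i j, m.val i j ∈ Zhat) ∧ IsHalfIntegral (twist G.T m) := by
  rw [act_fO, ← hermTwist_mem_J0Hat_iff]
  constructor
  · rintro ⟨w, hw, h⟩
    have hc := c_eq_of_toTri_eq h
    have hd := d_eq_of_toTri_eq h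
    dsimp only at hc hd
    exact ⟨hd ▸ hw.2.2.2, hc ▸ hw.2.2.1⟩
  · rintro ⟨hd, hc⟩
    refine Set.mem_image_of_mem _ ?_
    rw [WHat, Set.mem_ofPred_eq]
    exact ⟨zero_mem Zhat, zero_mem_J0Hat O, hc, hd⟩

end SpinGSp6

end

/-! ### The integral formula. -/

theorem proposition4p1 {α β : ℚ} (hα : α ≠ 0) (hβ : β ≠ 0) (hB : RamifiedAtInfinity α β)
    (B₀ : Subring (Quat α β ℚ)) (hB₀ : IsMaximalOrder B₀) (G : GoodBasis B₀)
    [MeasurableSpace (UP Af ⧸ U0 Af G.T)] [BorelSpace (UP Af ⧸ U0 Af G.T)]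
    (μ : MeasureTheory.Measure (UP Af ⧸ U0 Af G.T)) [μ.IsHaarMeasure]
    (hμ : μ ((fun u : UP Af => (u : UP Af ⧸ U0 Af G.T)) '' {u | trT G.T u ∈ Zhat}) = 1)
    (l : Afˣ) (m : GL (Fin 3) Af) :
    ∃ F : UP Af ⧸ U0 Af G.T → ℂ,
      (∀ u : UP Af,
        F u = chi G.T u * PhiF B₀ (act (G.fO Af).toTri ((u : GSp6 Af) * levi l m))) ∧
      MeasureTheory.Integrable F μ ∧
      ∫ x, F x ∂μ = (finiteAbs l : ℂ) * Xi G.T l m := by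
  classical
  obtain ⟨q, hq, hlq, hl⟩ := exists_rat_generator l
  have hT : G.Tᵀ = G.T := by
    rw [GoodBasis.T_eq]
    ext i j
    fin_cases i <;> fin_cases j <;> rfl
  set τ := trTQuot Af G.T
  have hτ : ∀ x y, τ (x * y) = τ x + τ y := trTQuot_mul G.T
  have hc : Continuous τ := continuous_trTQuot G.T
  have hs : Function.Surjective τ := fun t => by
    obtain ⟨u, hu⟩ := trT_surjective hT (G.T_ne_zero hα) t
    exact ⟨u, hu⟩
  -- `tr(Tu)` is constant on classes modulo `U_0`, so the image in `hμ` is exactly the level set of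
  -- `1`.
  have h1 : μ (level τ 1) = 1 := by
    rw [← hμ]
    congr 1
    ext x
    obtain ⟨u, rfl⟩ := QuotientGroup.mk_surjective x
    simp only [level, inv_one, map_one, one_mul, Set.mem_ofPred_eq, Set.mem_image]
    constructor
    · exact fun h => ⟨u, h, rfl⟩
    · rintro ⟨w, hw, h⟩
      rw [← h]
      exact hw
  have hlZ : (l : Af) ∈ Zhat ↔ algebraMap ℚ Af q ∈ Zhat := by
    simp only [mem_Zhat_iff, hlq, valued_algebraMap]
  have hchi : ∀ u : UP Af, chi G.T u * PhiF B₀ (act (G.fO Af).toTri ((u : GSp6 Af) * levi l m)) =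
      if (∀ i j, m.val i j ∈ Zhat) ∧ IsHalfIntegral (twist G.T m) then
        (level τ q).indicator (fun x => psi (τ x)) u else 0 := by
    intro u
    rw [PhiF, Set.indicator_apply, fO_act_mem_iff, inv_mul_mem_Zhat_iff hlq, Set.indicator_apply]
    change psi (trT G.T u) * _ = if _ then if algebraMap ℚ Af q⁻¹ * trT G.T u ∈ Zhat then
      psi (trT G.T u) else 0 else 0
    split_ifs <;> simp_all
  -- This condition does not involve `u`: when it fails the integrand is identically zero, and
  -- otherwise it is the indicator integrand in `τ`.
  by_cases hm : (∀ i j, m.val i j ∈ Zhat) ∧ IsHalfIntegral (twist G.T m)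
  · refine ⟨(level τ q).indicator fun x => psi (τ x), fun u => ?_,
      integrable_indicator_level μ hτ hc hs h1 hq, ?_⟩
    · rw [hchi, if_pos hm]
    · rw [integral_indicator_level μ hτ hc hs h1 hq, hl, Xi]
      simp only [hlZ, hm, and_true]
      split_ifs <;> simp_all
  · refine ⟨0, fun u => ?_, MeasureTheory.integrable_zero _ _ _, ?_⟩
    · rw [hchi, if_neg hm]; rfl
    · rw [Xi, if_neg fun h => hm h.2]
      simp
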